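/- Let $n>1$ and let $\Gamma\subset \mathsf{PSL}(2,\mathbb{R})$ be a discrete subgroup whose limit set $\Lambda(\Gamma)$ (the set of accumulation points of a $\Gamma$-orbit in the hyperbolic plane $\mathbb D$) is the whole circle $\partial\mathbb{D}$. Let $\mathcal F_\alpha=\mathsf{Sp}(2n,\mathbb R)/\mathsf P_\alpha$ be the manifold of Lagrangian subspaces of $\mathbb R^{2n}$, where $\mathsf P_\alpha$ is the stabilizer of $\mathcal L=\mathrm{Span}(e_1,\dots,e_n)$, and let $\mathcal L^{\mathrm{opp}}=\mathrm{Span}(e_{n+1},\dots,e_{2n})$. The group $\mathrm{Aut}(\mathfrak{sp}(2n,\mathbb R))$ acts on $\mathcal F_\alpha$ through the identification $g\mathsf P_\alpha\leftrightarrow \mathrm{Ad}_g(\mathfrak p_\alpha)$, $\mathfrak p_\alpha$ being the Lie algebra of $\mathsf P_\alpha$. For $N\ge 3$, an $N$-tuple in $\mathcal F_\alpha$ is positive if it is of the form $$g\big(\mathcal L,\;u_1\cdots u_{N-2}\mathcal L^{\mathrm{opp}},\;\dots,\;u_1u_2\mathcal L^{\mathrm{opp}},\;u_1\mathcal L^{\mathrm{opp}},\;\mathcal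 L^{\mathrm{opp}}\big),\qquad g\in \mathrm{Aut}(\mathfrak{sp}(2n,\mathbb R)),\quad u_i=\begin{pmatrix}\mathrm{Id}&M_i\\0&\mathrm{Id}\end{pmatrix},$$ with $M_i$ symmetric positive definite. Let $\rho:\Gamma\to\mathsf{Sp}(2n,\mathbb R)$ be a maximal representation with limit map $\xi^\alpha:\partial\mathbb D\to\mathcal F_\alpha$; that is, $\xi^\alpha$ is continuous, $\rho$-equivariant, and maps cyclically ordered $N$-tuples of distinct points to positive $N$-tuples for every $N\ge 3$. Let $\xi^1=\mathcal P_\alpha\circ\xi^\alpha:\partial\mathbb D\to\mathbb P(\bigwedge^n\mathbb R^{2n})$, where $\mathcal P_\alpha(g\mathsf P_\alpha)=\Lambda^n(g)[e_1\wedge\dots\wedge e_n]$ is the Plücker embedding. Let $m$ be the $1$-dimensional Hausdorff measure on the curve $\xi^1(\partial\mathbb D)$ with respect to the distance of any Riemannian metric on $\mathbb P(\bigwedge^n\mathbb R^{2n})$ (or, more generally, with respect to any distance bi-Lipschitz equivalent to such a one), and let $m^*$ be its pullback to $\partial\mathbb D$, $m^*(A)=m(\xi^1(A))$. For $x\in\partial\mathbb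 D$ let $\ell(x)$ denote the projective tangent line of $\xi^1(\partial\mathbb D)$ at $\xi^1(x)$ when it exists, i.e. the limit of the secant lines through $\xi^1(x)$ and $q$ as $q\to\xi^1(x)$ in $\xi^1(\partial\mathbb D)\setminus\{\xi^1(x)\}$, regarded as a $2$-dimensional subspace of $\bigwedge^n\mathbb R^{2n}$. For a subspace $W\subset\bigwedge^n\mathbb R^{2n}$ let $\mathrm{Ann}(W)=\{w : w\wedge v=0 \text{ in } \bigwedge^{2n}\mathbb R^{2n}\text{ for all } v\in W\}$. Let $\mathcal{ET}$ be the set of pairs $(x,y)$ of distinct points of $\partial\mathbb D$ for which both $\ell(x)$ and $\ell(y)$ exist and $\ell(y)\oplus\mathrm{Ann}(\ell(x))=\bigwedge^n\mathbb R^{2n}$. Then $m^*$ is a finite measure, $\mathcal{ET}$ is $m^*\times m^*$-measurable, and $$(m^*\times m^*)(\mathcal{ET})>0.$$ -/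

import Mathlib

open MeasureTheory Topology Filter Matrix
open scoped LinearAlgebra.Projectivization

noncomputable section

namespace MaxRep

/-! ### The hyperbolic plane, its boundary circle and discrete groups

The hyperbolic plane is the upper half plane `ℍ`, and its ideal boundary is `ℝ ∪ {∞}`. -/

/-- `PSL(2, ℝ)`. -/
abbrev PSL2 : Type := Matrix.ProjectiveSpecialLinearGroup (Fin 2) ℝ

/-- The quotient topology on `PSL(2, ℝ)`. -/
instance : TopologicalSpace PSL2 :=
  inferInstanceAs (TopologicalSpace
    (Matrix.SpecialLinearGroup (Fin 2) ℝ ⧸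
      Subgroup.center (Matrix.SpecialLinearGroup (Fin 2) ℝ)))

/-- The ideal boundary of the hyperbolic plane, a topological circle. -/
abbrev Bdry : Type := OnePoint ℝ

instance : MeasurableSpace Bdry := borel Bdry

instance : BorelSpace Bdry := ⟨rfl⟩

/-- The action of `PSL(2, ℝ)` on the ideal boundary by Möbius transformations. -/
def bdryAct (γ : PSL2) (x : Bdry) : Bdry :=
  (OnePoint.equivProjectivization ℝ).symm (γ • OnePoint.equivProjectivization ℝ x)

/-- The orbit of the base point `i` of the upper half plane, inside the Riemann sphere. -/
def orbitInSphere (Γ : Subgroup PSL2) : Set (OnePoint ℂ) :=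
  {z | ∃ g : Matrix.SpecialLinearGroup (Fin 2) ℝ, (QuotientGroup.mk g : PSL2) ∈ Γ ∧
    z = (((g • UpperHalfPlane.I : UpperHalfPlane) : ℂ) : OnePoint ℂ)}

/-- The limit set: the points of the ideal boundary at which the orbit accumulates. -/
def limitSet (Γ : Subgroup PSL2) : Set Bdry :=
  {x | AccPt (OnePoint.map Complex.ofReal x) (𝓟 (orbitInSphere Γ))}

/-- The boundary circle cut open at `∞`, with `∞` as its largest element. -/
def bdryCut (x : Bdry) : WithTop ℝ := x.elim ⊤ (fun t => (t : WithTop ℝ))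

/-- The cyclic order of the boundary circle. -/
def CyclicTriple (a b c : Bdry) : Prop :=
  (bdryCut a < bdryCut b ∧ bdryCut b < bdryCut c) ∨
  (bdryCut b < bdryCut c ∧ bdryCut c < bdryCut a) ∨
  (bdryCut c < bdryCut a ∧ bdryCut a < bdryCut b)

/-- Positive tuples of the boundary circle: distinct, cyclically ordered points. -/
def CyclicallyOrdered {N : ℕ} (x : Fin N → Bdry) : Prop :=
  ∀ i j k : Fin N, i < j → j < k → CyclicTriple (x i) (x j) (x k)

/-! ### The symplectic group and its flag manifold -/

section Flags

/-- Real `2n × 2n` matrices, in four blocks. -/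
abbrev Mat (n : ℕ) : Type := Matrix (Fin n ⊕ Fin n) (Fin n ⊕ Fin n) ℝ

/-- `Sp(2n, ℝ)`, acting on `ℝ²ⁿ = ℝⁿ ⊕ ℝⁿ`. -/
abbrev Sp (n : ℕ) : Type := Matrix.symplecticGroup (Fin n) ℝ

attribute [local instance 100] LieRing.ofAssociativeRing

/-- The Lie algebra `sp(2n, ℝ)`. -/
abbrev spAlg (n : ℕ) : LieSubalgebra ℝ (Mat n) :=
  LieAlgebra.Symplectic.sp (Fin n) ℝ

/-- The parabolic subgroup `P_α` of block upper triangular matrices. -/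
def parabolic (n : ℕ) : Subgroup (Sp n) where
  carrier := {g | (g : Mat n).toBlocks₂₁ = 0}
  one_mem' := by
    ext i j
    simp [Matrix.toBlocks₂₁]
  mul_mem' := by
    intro a b ha hb
    ext i j
    have ha' : ∀ i j, (a : Mat n) (Sum.inr i) (Sum.inl j) = 0 :=
      fun i j => congrFun (congrFun ha i) j
    have hb' : ∀ i j, (b : Mat n) (Sum.inr i) (Sum.inl j) = 0 :=
      fun i j => congrFun (congrFun hb i) j
    simp [Matrix.toBlocks₂₁, Matrix.mul_apply, Fintype.sum_sum_type, ha', hb']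
  inv_mem' := by
    intro a ha
    have ha' : ∀ i j, (a : Mat n) (Sum.inr i) (Sum.inl j) = 0 :=
      fun i j => congrFun (congrFun ha i) j
    ext i j
    simp [Matrix.toBlocks₂₁, SymplecticGroup.coe_inv, Matrix.J, Matrix.mul_apply,
      Fintype.sum_sum_type, ha', Matrix.one_apply]

/-- The flag manifold `F_α = Sp(2n, ℝ) / P_α` with its quotient topology and `Sp(2n, ℝ)`-action. -/
abbrev Flag (n : ℕ) : Type := Sp n ⧸ parabolic n

/-- The matrix `Ω` of the symplectic form. -/
def Omega (n : ℕ) : Sp n :=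
  ⟨-Matrix.J (Fin n) ℝ, SymplecticGroup.neg_mem (SymplecticGroup.J_mem (Fin n) ℝ)⟩

/-- The base flag, corresponding to the Lagrangian `Span(e₁, …, eₙ)`. -/
def flagL (n : ℕ) : Flag n := ((1 : Sp n) : Flag n)

/-- The opposite base flag, corresponding to the Lagrangian `Span(eₙ₊₁, …, e₂ₙ)`. -/
def flagLopp (n : ℕ) : Flag n := ((Omega n : Sp n) : Flag n)

/-- `U_α^{>0}`: the unipotent matrices `(1 M; 0 1)` with `M` symmetric positive definite. -/
def UPos (n : ℕ) : Set (Sp n) :=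
  {g | ∃ M : Matrix (Fin n) (Fin n) ℝ, M.PosDef ∧
    (g : Mat n) = Matrix.fromBlocks 1 M 0 1}

/-- The parabolic subalgebra `Ad_g(p_α)` of `sp(2n, ℝ)` that is attached to the flag `g P_α`,
where `p_α` is the algebra of block upper triangular elements of `sp(2n, ℝ)`. -/
def parabolicAlg {n : ℕ} (x : Flag n) : Set (spAlg n) :=
  {X | ∃ g : Sp n, (g : Flag n) = x ∧ ∃ Y : spAlg n,
    (Y : Mat n).toBlocks₂₁ = 0 ∧
    (X : Mat n) = (g : Mat n) * (Y : Mat n) * ((g⁻¹ : Sp n) : Mat n)}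

/-- The standard positive tuple
`(L, u₁ ⋯ u_{N-2} Lᵒᵖᵖ, …, u₁ u₂ Lᵒᵖᵖ, u₁ Lᵒᵖᵖ, Lᵒᵖᵖ)`. -/
def stdTuple {n N : ℕ} (u : Fin (N - 2) → Sp n) (j : Fin N) : Flag n :=
  if (j : ℕ) = 0 then flagL n
  else ((List.ofFn u).take (N - 1 - (j : ℕ))).prod • flagLopp n

/-- Positive tuples of flags: the images of the standard ones under `Aut(sp(2n, ℝ))`, which acts
on flags through their parabolic subalgebras. -/
def IsPositiveTuple {n N : ℕ} (x : Fin N → Flag n) : Prop :=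
  ∃ (φ : spAlg n ≃ₗ⁅ℝ⁆ spAlg n) (u : Fin (N - 2) → Sp n),
    (∀ i, u i ∈ UPos n) ∧ ∀ j, parabolicAlg (x j) = φ '' parabolicAlg (stdTuple u j)

/-- `ξ` is a limit map that makes `ρ` a maximal representation, for a group `Γ` whose limit set is
the whole circle: `ξ` is continuous, `ρ`-equivariant, and maps positive tuples to positive
tuples. -/
structure IsMaximalLimitMap {n : ℕ} (Γ : Subgroup PSL2) (ρ : Γ →* Sp n) (ξ : Bdry → Flag n) :
    Prop where
  continuous : Continuous ξ
  equivariant : ∀ (γ : Γ) (x : Bdry), ξ (bdryAct γ x) = ρ γ • ξ x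
  positive : ∀ (N : ℕ), 3 ≤ N → ∀ x : Fin N → Bdry, CyclicallyOrdered x →
    IsPositiveTuple (fun i => ξ (x i))

end Flags

/-! ### The exterior power `⋀ⁿ ℝ²ⁿ` -/

/-- `ℝ²ⁿ`. -/
abbrev Std (n : ℕ) : Type := Fin n ⊕ Fin n → ℝ

/-- `⋀ⁿ ℝ²ⁿ`. -/
abbrev Wedge (n : ℕ) : Type := ⋀[ℝ]^n (Std n)

/-- The standard basis `e₁, …, e₂ₙ`. -/
def stdBasis (n : ℕ) : Module.Basis (Fin (n + n)) ℝ (Std n) :=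
  (Pi.basisFun ℝ (Fin n ⊕ Fin n)).reindex finSumFinEquiv

/-- The linear form on `⋀²ⁿ ℝ²ⁿ` with value `1` at `e₁ ∧ ⋯ ∧ e₂ₙ`. -/
def volForm (n : ℕ) : ⋀[ℝ]^(n + n) (Std n) →ₗ[ℝ] ℝ :=
  exteriorPower.alternatingMapLinearEquiv (stdBasis n).det

/-- The wedge product `⋀ⁿ × ⋀ⁿ → ⋀²ⁿ`. -/
def wedgeMul {n : ℕ} (v w : Wedge n) : ⋀[ℝ]^(n + n) (Std n) :=
  ⟨(v : ExteriorAlgebra ℝ (Std n)) * (w : ExteriorAlgebra ℝ (Std n)), by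
    have h := Submodule.mul_mem_mul v.2 w.2
    rwa [← pow_add] at h⟩

/-- The bilinear form `ω'(v, w) = (v ∧ w) / (e₁ ∧ ⋯ ∧ e₂ₙ)`. -/
def omega' (n : ℕ) : Wedge n →ₗ[ℝ] Wedge n →ₗ[ℝ] ℝ :=
  LinearMap.mk₂ ℝ (fun v w => volForm n (wedgeMul v w))
    (fun v v' w => by
      rw [← map_add]; congr 1; ext1; simp [wedgeMul, add_mul])
    (fun c v w => by
      rw [← map_smul]; congr 1; ext1; simp [wedgeMul])
    (fun v w w' => by
      rw [← map_add]; congr 1; ext1; simp [wedgeMul, mul_add])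
    (fun c v w => by
      rw [← map_smul]; congr 1; ext1; simp [wedgeMul])

/-- The annihilator of a subspace with respect to `ω'`. -/
def Ann {n : ℕ} (W : Submodule ℝ (Wedge n)) : Submodule ℝ (Wedge n) where
  carrier := {w | ∀ v ∈ W, omega' n w v = 0}
  zero_mem' := by intro v _; simp
  add_mem' := by
    intro a b ha hb v hv
    simp [ha v hv, hb v hv]
  smul_mem' := by
    intro c a ha v hv
    simp [ha v hv]

/-- The Euclidean space in which the `e_I` (`I ⊆ {1, …, 2n}`, `|I| = n`) are orthonormal. -/
abbrev WedgeEuc (n : ℕ) : Type := EuclideanSpace ℝ (Set.powersetCard (Fin (n + n)) n)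

/-- The coordinates of an element of `⋀ⁿ ℝ²ⁿ` in the standard basis `(e_I)`. -/
def wedgeCoord (n : ℕ) : Wedge n ≃ₗ[ℝ] WedgeEuc n :=
  ((stdBasis n).exteriorPower n).equivFun ≪≫ₗ (WithLp.linearEquiv 2 ℝ _).symm

/-- The orthogonal projection onto a subspace of `⋀ⁿ ℝ²ⁿ`; it embeds the Grassmannians, with their
usual topology, into the space of linear maps. -/
def subspaceProj {n : ℕ} (W : Submodule ℝ (Wedge n)) : WedgeEuc n →L[ℝ] WedgeEuc n :=
  (W.map (wedgeCoord n).toLinearMap).starProjection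

theorem subspaceProj_injective {n : ℕ} :
    Function.Injective (subspaceProj : Submodule ℝ (Wedge n) → _) := by
  intro W W' h
  have h' := Submodule.starProjection_inj.mp h
  exact Submodule.map_injective_of_injective (wedgeCoord n).injective h'

/-- The standard (chordal) distance of the projective space `ℙ(⋀ⁿ ℝ²ⁿ)`: the sine of the angle
between two lines. -/
instance (n : ℕ) : MetricSpace (ℙ ℝ (Wedge n)) :=
  MetricSpace.induced (fun p => subspaceProj p.submodule)
    (subspaceProj_injective.comp Projectivization.submodule_injective) inferInstance

/-- The standard distance of `ℙ(⋀ⁿ ℝ²ⁿ)` as a function. -/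
def stdDist {n : ℕ} (p q : ℙ ℝ (Wedge n)) : ℝ := dist p q

/-- A metric on `ℙ(⋀ⁿ ℝ²ⁿ)` that is bi-Lipschitz to the standard one, for instance the distance
of an arbitrary Riemannian metric. -/
def IsBiLipschitzToStd {n : ℕ} (D : MetricSpace (ℙ ℝ (Wedge n))) : Prop :=
  ∃ K : ℝ, 0 < K ∧ ∀ p q : ℙ ℝ (Wedge n),
    D.dist p q ≤ K * stdDist p q ∧ stdDist p q ≤ K * D.dist p q

/-! ### The Plücker embedding -/

/-- `e₁ ∧ ⋯ ∧ eₙ`. -/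
def wedgeBase (n : ℕ) : Wedge n :=
  exteriorPower.ιMulti ℝ n (fun i : Fin n => (Pi.single (Sum.inl i) 1 : Std n))

/-- The wedge representation `Λⁿ`. -/
def wedgeRep {n : ℕ} (g : Sp n) : Wedge n →ₗ[ℝ] Wedge n :=
  exteriorPower.map n (Matrix.mulVecLin (g : Mat n))

theorem wedgeRep_mul {n : ℕ} (g h : Sp n) : wedgeRep (g * h) = wedgeRep g ∘ₗ wedgeRep h := by
  simp [wedgeRep, Matrix.mulVecLin_mul, exteriorPower.map_comp]

theorem wedgeRep_one {n : ℕ} : wedgeRep (1 : Sp n) = LinearMap.id := by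
  simp [wedgeRep]

theorem wedgeRep_injective {n : ℕ} (g : Sp n) : Function.Injective (wedgeRep g) := by
  apply Function.LeftInverse.injective (g := wedgeRep g⁻¹)
  intro v
  rw [← LinearMap.comp_apply, ← wedgeRep_mul, inv_mul_cancel, wedgeRep_one, LinearMap.id_apply]

theorem wedgeBase_ne_zero (n : ℕ) : wedgeBase n ≠ 0 := by
  intro h
  let f : Std n [⋀^Fin n]→ₗ[ℝ] ℝ :=
    (Pi.basisFun ℝ (Fin n)).det.compLinearMap (LinearMap.funLeft ℝ ℝ Sum.inl)
  have h1 : exteriorPower.alternatingMapLinearEquiv f (wedgeBase n) = 1 := by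
    rw [wedgeBase, exteriorPower.alternatingMapLinearEquiv_apply_ιMulti]
    have h2 : (fun i : Fin n => LinearMap.funLeft ℝ ℝ (Sum.inl : Fin n → Fin n ⊕ Fin n)
        (Pi.single (Sum.inl i) 1 : Std n)) = Pi.basisFun ℝ (Fin n) := by
      ext i j
      simp [LinearMap.funLeft_apply, Pi.single_apply]
    change (Pi.basisFun ℝ (Fin n)).det (fun i => _) = 1
    rw [h2, Module.Basis.det_self]
  rw [h, map_zero] at h1
  exact zero_ne_one h1

theorem wedgeRep_parabolic {n : ℕ} (p : Sp n) (hp : p ∈ parabolic n) :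
    wedgeRep p (wedgeBase n) =
      (p : Mat n).toBlocks₁₁.det • wedgeBase n := by
  set A := (p : Mat n) with hA
  let T : (Fin n → ℝ) →ₗ[ℝ] Std n :=
    (Pi.basisFun ℝ (Fin n)).constr ℝ (fun i => (Pi.single (Sum.inl i) 1 : Std n))
  let F : (Fin n → ℝ) [⋀^Fin n]→ₗ[ℝ] Wedge n := (exteriorPower.ιMulti ℝ n).compLinearMap T
  have hT : ∀ v : Fin n → ℝ, T v = Sum.elim v 0 := by
    intro v
    ext j
    cases j <;> simp [T, Module.Basis.constr_apply_fintype, Pi.single_apply]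
  have hF : F = (LinearMap.toSpanSingleton ℝ (Wedge n) (wedgeBase n)).compAlternatingMap
      (Pi.basisFun ℝ (Fin n)).det := by
    refine Module.Basis.ext_alternating (Pi.basisFun ℝ (Fin n)) ?_
    intro v hv
    obtain ⟨σ, rfl⟩ : ∃ σ : Equiv.Perm (Fin n), ⇑σ = v :=
      ⟨Equiv.ofBijective v (Finite.injective_iff_bijective.mp hv), rfl⟩
    have hb : F (Pi.basisFun ℝ (Fin n)) = wedgeBase n := by
      simp [F, T, wedgeBase, AlternatingMap.compLinearMap_apply]
    have h1 := F.map_perm (Pi.basisFun ℝ (Fin n)) σ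
    have h2 := (Pi.basisFun ℝ (Fin n)).det.map_perm (Pi.basisFun ℝ (Fin n)) σ
    simp only [Function.comp_def] at h1 h2
    rw [LinearMap.compAlternatingMap_apply, h1, h2, Module.Basis.det_self, hb]
    simp [Units.smul_def, Int.cast_smul_eq_zsmul]
  have hcol : (fun i : Fin n => Matrix.mulVecLin A (Pi.single (Sum.inl i) 1 : Std n)) =
      fun i => T (fun j => A.toBlocks₁₁ j i) := by
    funext i
    ext j
    rw [hT]
    cases j with
    | inl j => simp [Matrix.toBlocks₁₁]
    | inr j =>
      have := congrFun (congrFun hp j) i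
      simpa [Matrix.toBlocks₂₁] using this
  have h3 : wedgeRep p (wedgeBase n) = F (fun i => fun j => A.toBlocks₁₁ j i) := by
    rw [wedgeRep, wedgeBase, exteriorPower.map_apply_ιMulti]
    exact congrArg (exteriorPower.ιMulti ℝ n) hcol
  rw [h3, hF, LinearMap.compAlternatingMap_apply, LinearMap.toSpanSingleton_apply,
    Pi.basisFun_det]
  congr 1
  exact Matrix.det_transpose _

/-- The Plücker embedding `g P_α ↦ Λⁿ(g)[e₁ ∧ ⋯ ∧ eₙ]`. -/
def plucker {n : ℕ} : Flag n → ℙ ℝ (Wedge n) :=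
  Quotient.lift
    (fun g : Sp n => Projectivization.mk ℝ (wedgeRep g (wedgeBase n))
      (fun h => wedgeBase_ne_zero n (wedgeRep_injective g (by rw [h, map_zero]))))
    (by
      intro g h hgh
      have hp : g⁻¹ * h ∈ parabolic n := QuotientGroup.leftRel_apply.mp hgh
      rw [Projectivization.mk_eq_mk_iff']
      have h1 : wedgeRep h (wedgeBase n) = wedgeRep g (wedgeRep (g⁻¹ * h) (wedgeBase n)) := by
        rw [← LinearMap.comp_apply, ← wedgeRep_mul, mul_inv_cancel_left]
      rw [wedgeRep_parabolic _ hp, map_smul] at h1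
      have hd : ((g⁻¹ * h : Sp n) : Mat n).toBlocks₁₁.det
          ≠ 0 := by
        intro h0
        rw [h0, zero_smul] at h1
        exact wedgeBase_ne_zero n (wedgeRep_injective h (by rw [h1, map_zero]))
      exact ⟨_, by rw [h1, smul_smul, inv_mul_cancel₀ hd, one_smul]⟩)

/-! ### Tangent lines, transverse pairs and the length measure -/

/-- `ℓ` (a projective line, that is, a plane of `⋀ⁿ ℝ²ⁿ`) is the tangent line at `p` of the set
`C`: the secant lines through `p` and `q` converge to `ℓ` when `q` tends to `p` inside `C`. -/
def IsTangentLine {n : ℕ} (C : Set (ℙ ℝ (Wedge n))) (p : ℙ ℝ (Wedge n))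
    (ℓ : Submodule ℝ (Wedge n)) : Prop :=
  Module.finrank ℝ ℓ = 2 ∧
    Tendsto (fun q : ℙ ℝ (Wedge n) => subspaceProj (p.submodule ⊔ q.submodule))
      (𝓝[C \ {p}] p) (𝓝 (subspaceProj ℓ))

/-- The set `ET` of pairs of distinct points at which both tangent lines `ℓ(x)`, `ℓ(y)` of the
curve `ξ¹` exist and `ℓ(y)` is transverse to `Ann(ℓ(x))`. -/
def transversePairs {n : ℕ} (ξ₁ : Bdry → ℙ ℝ (Wedge n)) : Set (Bdry × Bdry) :=
  {z | z.1 ≠ z.2 ∧ ∃ ℓx ℓy : Submodule ℝ (Wedge n),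
    IsTangentLine (Set.range ξ₁) (ξ₁ z.1) ℓx ∧ IsTangentLine (Set.range ξ₁) (ξ₁ z.2) ℓy ∧
    IsCompl ℓy (Ann ℓx)}

/-- The pullback under `f` of the one-dimensional Hausdorff measure of a metric space: a set `s`
has measure `ℋ¹(f(s))`. -/
def pullbackLength {S X : Type*} [MeasurableSpace S] (D : MetricSpace X) (f : S → X) :
    Measure S :=
  letI : MeasurableSpace X := borel X
  haveI : BorelSpace X := ⟨rfl⟩
  Measure.comap f (Measure.hausdorffMeasure 1)

end MaxRep

end

noncomputable section

namespace MaxRep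

/-! ### Definite symmetric matrices -/

/-- A real matrix that is positive definite or negative definite. -/
def IsDefinite {n : ℕ} (M : Matrix (Fin n) (Fin n) ℝ) : Prop := M.PosDef ∨ (-M).PosDef

theorem IsDefinite.isUnit {n : ℕ} {M : Matrix (Fin n) (Fin n) ℝ} (h : IsDefinite M) :
    IsUnit M := by
  rcases h with h | h
  · exact h.isUnit
  · simpa using h.isUnit.neg

theorem IsDefinite.neg {n : ℕ} {M : Matrix (Fin n) (Fin n) ℝ} (h : IsDefinite M) :
    IsDefinite (-M) := by
  rcases h with h | h
  · exact Or.inr (by simpa using h)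
  · exact Or.inl h

theorem posSemidef_abs_apply_le_trace {n : ℕ} {M : Matrix (Fin n) (Fin n) ℝ} (h : M.PosSemidef)
    (i j : Fin n) : |M i j| ≤ M.trace := by
  have hd : ∀ k, 0 ≤ M k k := fun k => h.diag_nonneg
  have hs : M j i = M i j := by simpa using h.1.apply i j
  have htr : ∀ k, M k k ≤ M.trace := fun k =>
    Finset.single_le_sum (f := fun k => M k k) (fun k _ => hd k) (Finset.mem_univ k)
  have key : ∀ c : ℝ, 0 ≤ M i i + 2 * c * M i j + c ^ 2 * M j j := by
    intro c
    have := h.dotProduct_mulVec_nonneg (Pi.single i 1 + c • Pi.single j 1)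
    simp [Matrix.mulVec_add, Matrix.mulVec_smul, add_dotProduct, dotProduct_add, hs] at this
    nlinarith
  have h1 := key 1
  have h2 := key (-1)
  have := htr i
  have := htr j
  rw [abs_le]
  constructor <;> linarith

theorem IsDefinite.abs_apply_le_abs_trace {n : ℕ} {M : Matrix (Fin n) (Fin n) ℝ}
    (h : IsDefinite M) (i j : Fin n) : |M i j| ≤ |M.trace| := by
  rcases h with h | h
  · exact (posSemidef_abs_apply_le_trace h.posSemidef i j).trans (le_abs_self _)
  · have := posSemidef_abs_apply_le_trace h.posSemidef i j
    simp only [Matrix.neg_apply, abs_neg, Matrix.trace_neg] at this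
    exact this.trans (neg_le_abs _)

theorem IsDefinite.trace_ne_zero {n : ℕ} (hn : 0 < n) {M : Matrix (Fin n) (Fin n) ℝ}
    (h : IsDefinite M) : M.trace ≠ 0 := by
  have : Nonempty (Fin n) := ⟨⟨0, hn⟩⟩
  rcases h with h | h
  · exact h.trace_pos.ne'
  · have := h.trace_pos
    rw [Matrix.trace_neg] at this
    linarith

/-- A symmetric matrix `N` such that the half-line from `N` in the direction of a positive definite
matrix consists of invertible matrices is positive definite. -/
theorem posDef_of_forall_isUnit_add {n : ℕ} {M N : Matrix (Fin n) (Fin n) ℝ} (hM : M.PosDef)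
    (hN : N.IsSymm) (h : ∀ t : ℝ, 0 ≤ t → IsUnit (N + t • M)) : N.PosDef := by
  have hNh : N.IsHermitian := by
    rw [Matrix.IsHermitian, Matrix.conjTranspose_eq_transpose_of_trivial]
    exact hN
  by_contra hcon
  -- a minimizer of the Rayleigh quotient
  obtain ⟨x, hx0, hxN⟩ : ∃ x : Fin n → ℝ, x ≠ 0 ∧ x ⬝ᵥ N *ᵥ x ≤ 0 := by
    by_contra! hall
    exact hcon (Matrix.PosDef.of_dotProduct_mulVec_pos hNh (fun x hx => by simpa using hall x hx))
  have hMpos : ∀ x : Fin n → ℝ, x ≠ 0 → 0 < x ⬝ᵥ M *ᵥ x := fun x hx => by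
    simpa using hM.dotProduct_mulVec_pos hx
  let q : (Fin n → ℝ) → ℝ := fun x => (x ⬝ᵥ N *ᵥ x) / (x ⬝ᵥ M *ᵥ x)
  have hcont : ContinuousOn q (Metric.sphere 0 1) := by
    apply ContinuousOn.div
    · fun_prop
    · fun_prop
    · intro y hy
      refine (hMpos y ?_).ne'
      rintro rfl
      simp at hy
  have hscale : ∀ (c : ℝ) (y : Fin n → ℝ), c ≠ 0 → q (c • y) = q y := by
    intro c y hc
    simp only [q, Matrix.mulVec_smul, smul_dotProduct, dotProduct_smul, smul_eq_mul]
    field_simp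
  have hnorm : ∀ y : Fin n → ℝ, y ≠ 0 → ‖y‖⁻¹ • y ∈ Metric.sphere (0 : Fin n → ℝ) 1 := by
    intro y hy
    simp [norm_smul, inv_mul_cancel₀ (norm_ne_zero_iff.mpr hy)]
  obtain ⟨z, hz, hzmin⟩ := (isCompact_sphere (0 : Fin n → ℝ) 1).exists_isMinOn
    ⟨_, hnorm x hx0⟩ hcont
  have hz0 : z ≠ 0 := by
    rintro rfl
    simp at hz
  have hmin : ∀ y : Fin n → ℝ, y ≠ 0 → q z ≤ q y := by
    intro y hy
    rw [← hscale ‖y‖⁻¹ y (inv_ne_zero (norm_ne_zero_iff.mpr hy))]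
    exact hzmin (hnorm y hy)
  have hqz : q z ≤ 0 := (hmin x hx0).trans (div_nonpos_of_nonpos_of_nonneg hxN (hMpos x hx0).le)
  have hpsd : (N + (-q z) • M).PosSemidef := by
    refine Matrix.PosSemidef.of_dotProduct_mulVec_nonneg
      (hNh.add (by
        rw [Matrix.IsHermitian, Matrix.conjTranspose_smul, hM.isHermitian.eq]; simp)) ?_
    intro y
    by_cases hy : y = 0
    · simp [hy]
    · have h1 := hmin y hy
      have h2 := hMpos y hy
      have h3 : q y * (y ⬝ᵥ M *ᵥ y) = y ⬝ᵥ N *ᵥ y := div_mul_cancel₀ _ h2.ne'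
      simp only [star_trivial, Matrix.add_mulVec, Matrix.smul_mulVec, dotProduct_add,
        dotProduct_smul, smul_eq_mul]
      nlinarith
  have hker : (N + (-q z) • M) *ᵥ z = 0 := by
    rw [← hpsd.dotProduct_mulVec_zero_iff]
    have h3 : q z * (z ⬝ᵥ M *ᵥ z) = z ⬝ᵥ N *ᵥ z := div_mul_cancel₀ _ (hMpos z hz0).ne'
    simp only [star_trivial, Matrix.add_mulVec, Matrix.smul_mulVec, dotProduct_add,
      dotProduct_smul, smul_eq_mul]
    linarith
  have hu := h (-q z) (by linarith)
  exact hz0 (Matrix.mulVec_injective_of_isUnit hu (by rw [hker, Matrix.mulVec_zero]))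

/-- For an invertible indefinite symmetric matrix `N`, the cone of symmetric matrices whose
half-lines in direction `N` consist of invertible matrices is not closed under addition. -/
theorem exists_of_not_isDefinite {n : ℕ} {N : Matrix (Fin n) (Fin n) ℝ} (hN : N.IsSymm)
    (hu : IsUnit N) (hdef : ¬ IsDefinite N) :
    ∃ A B : Matrix (Fin n) (Fin n) ℝ, A.IsSymm ∧ B.IsSymm ∧
      (∀ t : ℝ, 0 ≤ t → IsUnit (A + t • N)) ∧ (∀ t : ℝ, 0 ≤ t → IsUnit (B + t • N)) ∧
      ¬ IsUnit (A + B + (2 : ℝ) • N) := by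
  have hNh : N.IsHermitian := by
    rw [Matrix.IsHermitian, Matrix.conjTranspose_eq_transpose_of_trivial]
    exact hN
  set d := hNh.eigenvalues with hd
  set U : Matrix (Fin n) (Fin n) ℝ := (hNh.eigenvectorUnitary).1 with hU
  have hUU : U * Uᵀ = 1 := by
    have := Unitary.coe_mul_star_self hNh.eigenvectorUnitary
    simpa [Matrix.star_eq_conjTranspose] using this
  have hUU' : Uᵀ * U = 1 := by
    have := Unitary.coe_star_mul_self hNh.eigenvectorUnitary
    simpa [Matrix.star_eq_conjTranspose] using this
  have hspec : N = U * Matrix.diagonal d * Uᵀ := by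
    have := hNh.spectral_theorem
    rw [Unitary.conjStarAlgAut_apply] at this
    simpa [Matrix.star_eq_conjTranspose, Function.comp_def] using this
  have hunit : ∀ X : Matrix (Fin n) (Fin n) ℝ, IsUnit (U * X * Uᵀ) ↔ IsUnit X := by
    intro X
    have h1 : IsUnit U := IsUnit.of_mul_eq_one _ hUU
    have h2 : IsUnit Uᵀ := IsUnit.of_mul_eq_one _ hUU'
    rw [h2.mul_right_iff, h1.mul_left_iff]
  have hd0 : ∀ i, d i ≠ 0 := by
    have : IsUnit (Matrix.diagonal d) := by rw [← hunit, ← hspec]; exact hu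
    rw [Matrix.isUnit_diagonal, Pi.isUnit_iff] at this
    exact fun i => (this i).ne_zero
  obtain ⟨p, hp⟩ : ∃ p, 0 < d p := by
    by_contra! hall
    refine hdef (Or.inr ?_)
    have : -N = U * Matrix.diagonal (-d) * Uᵀ := by
      have hneg : Matrix.diagonal (-d) = -Matrix.diagonal d := (Matrix.diagonal_neg d).symm
      rw [hspec, hneg, Matrix.mul_neg, Matrix.neg_mul]
    rw [this]
    have hpd : (Matrix.diagonal (-d)).PosDef := Matrix.PosDef.diagonal (fun i => by
      have := lt_of_le_of_ne (hall i) (hd0 i)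
      simpa using this)
    have h2 : IsUnit Uᵀ := IsUnit.of_mul_eq_one _ hUU'
    have h3 := hpd.conjTranspose_mul_mul_same (B := Uᵀ) (Matrix.mulVec_injective_of_isUnit h2)
    simpa using h3
  obtain ⟨q, hq⟩ : ∃ q, d q < 0 := by
    by_contra! hall
    refine hdef (Or.inl ?_)
    exact hNh.posDef_iff_eigenvalues_pos.mpr fun i => lt_of_le_of_ne (hall i) (hd0 i).symm
  have hpq : p ≠ q := by rintro rfl; linarith
  let E : ℝ → Matrix (Fin n) (Fin n) ℝ := fun a =>
    Matrix.diagonal (fun i => if i = p ∨ i = q then -d i else d i) +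
      (Matrix.single p q a + Matrix.single q p a)
  have hE : ∀ a, (E a)ᵀ = E a := by
    intro a
    simp only [E, Matrix.transpose_add, Matrix.diagonal_transpose, Matrix.transpose_single]
    rw [add_comm (Matrix.single q p a)]
  have hEsymm : ∀ a, (U * E a * Uᵀ).IsSymm := by
    intro a
    simp [Matrix.IsSymm, Matrix.transpose_mul, hE, Matrix.mul_assoc]
  have hEunit : ∀ a : ℝ, a ≠ 0 → ∀ t : ℝ, 0 ≤ t → IsUnit (U * E a * Uᵀ + t • N) := by
    intro a ha t ht
    have h1 : U * E a * Uᵀ + t • N = U * (E a + t • Matrix.diagonal d) * Uᵀ := by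
      conv_lhs => rw [hspec]
      simp [Matrix.mul_add, Matrix.add_mul]
    rw [h1, hunit, Matrix.isUnit_iff_isUnit_det, isUnit_iff_ne_zero]
    intro hdet
    obtain ⟨v, hv0, hv⟩ := Matrix.exists_mulVec_eq_zero_iff.mpr hdet
    have hvi : ∀ i, (if i = p ∨ i = q then -d i else d i) * v i +
        ((if i = p then a * v q else 0) + (if i = q then a * v p else 0)) + t * (d i * v i) = 0 := by
      intro i
      have := congrFun hv i
      simp only [E, Matrix.add_mulVec, Matrix.smul_mulVec, Pi.add_apply, Pi.smul_apply,
        Matrix.mulVec_diagonal, Matrix.single_mulVec, Function.update_apply, Pi.zero_apply,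
        smul_eq_mul] at this
      exact this
    apply hv0
    have e1 := hvi p
    have e2 := hvi q
    simp only [hpq, hpq.symm, if_true, if_false, true_or, or_true, add_zero, zero_add] at e1 e2
    have hdd : d p * d q < 0 := mul_neg_of_pos_of_neg hp hq
    have ha2 : 0 < a ^ 2 := by positivity
    have hne : (t - 1) ^ 2 * (d p * d q) - a ^ 2 ≠ 0 := by nlinarith [sq_nonneg (t - 1)]
    have hvp : v p = 0 := by
      have : ((t - 1) ^ 2 * (d p * d q) - a ^ 2) * v p = 0 := by
        linear_combination (t - 1) * d q * e1 - a * e2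
      exact (mul_eq_zero.mp this).resolve_left hne
    have hvq : v q = 0 := by
      have : ((t - 1) ^ 2 * (d p * d q) - a ^ 2) * v q = 0 := by
        linear_combination (t - 1) * d p * e2 - a * e1
      exact (mul_eq_zero.mp this).resolve_left hne
    funext i
    by_cases hip : i = p
    · rw [hip]; exact hvp
    by_cases hiq : i = q
    · rw [hiq]; exact hvq
    have e3 := hvi i
    simp only [hip, hiq, if_false, or_self, add_zero] at e3
    have : (1 + t) * d i * v i = 0 := by linear_combination e3
    have h2 : (1 + t) * d i ≠ 0 := mul_ne_zero (by linarith) (hd0 i)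
    exact (mul_eq_zero.mp this).resolve_left h2
  refine ⟨U * E 1 * Uᵀ, U * E (-1) * Uᵀ, hEsymm 1, hEsymm (-1), hEunit 1 one_ne_zero,
    hEunit (-1) (by norm_num), ?_⟩
  have h1 : U * E 1 * Uᵀ + U * E (-1) * Uᵀ + (2 : ℝ) • N =
      U * (E 1 + E (-1) + (2 : ℝ) • Matrix.diagonal d) * Uᵀ := by
    conv_lhs => rw [hspec]
    simp [Matrix.mul_add, Matrix.add_mul]
  rw [h1, hunit]
  intro hu2
  have h3 : (E 1 + E (-1) + (2 : ℝ) • Matrix.diagonal d) *ᵥ (Pi.single p 1) = 0 := by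
    funext i
    simp only [E, Matrix.add_mulVec, Matrix.smul_mulVec, Pi.add_apply, Pi.smul_apply,
        Matrix.mulVec_diagonal, Matrix.single_mulVec, Function.update_apply, Pi.zero_apply,
        smul_eq_mul, Pi.single_apply]
    by_cases hip : i = p
    · subst hip
      simp [hpq, hpq.symm]; ring
    · by_cases hiq : i = q <;> simp [hip, hiq, hpq.symm]
  have := Matrix.mulVec_injective_of_isUnit hu2 (h3.trans (Matrix.mulVec_zero _).symm)
  have := congrFun this p
  simp at this

/-- A linear bijection of the symmetric matrices that preserves invertibility in both directions
maps positive definite matrices to definite ones. -/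
theorem isDefinite_of_preserves_isUnit {n : ℕ} {V : Type*} [AddCommGroup V] [Module ℝ V]
    (ι κ : V → Matrix (Fin n) (Fin n) ℝ)
    (hιadd : ∀ x y, ι (x + y) = ι x + ι y) (hιsmul : ∀ (c : ℝ) x, ι (c • x) = c • ι x)
    (hκadd : ∀ x y, κ (x + y) = κ x + κ y) (hκsmul : ∀ (c : ℝ) x, κ (c • x) = c • κ x)
    (hιs : ∀ x, (ι x).IsSymm) (hκs : ∀ x, (κ x).IsSymm)
    (hκ : ∀ A : Matrix (Fin n) (Fin n) ℝ, A.IsSymm → ∃ x, κ x = A)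
    (hu : ∀ x, IsUnit (ι x) ↔ IsUnit (κ x)) {x : V} (hx : (ι x).PosDef) : IsDefinite (κ x) := by
  by_contra hcon
  obtain ⟨A, B, hA, hB, hA', hB', hAB⟩ :=
    exists_of_not_isDefinite (hκs x) ((hu x).mp hx.isUnit) hcon
  obtain ⟨a, rfl⟩ := hκ A hA
  obtain ⟨b, rfl⟩ := hκ B hB
  have ha : (ι a).PosDef := posDef_of_forall_isUnit_add hx (hιs a) fun t ht => by
    rw [← hιsmul, ← hιadd, hu, hκadd, hκsmul]; exact hA' t ht
  have hb : (ι b).PosDef := posDef_of_forall_isUnit_add hx (hιs b) fun t ht => by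
    rw [← hιsmul, ← hιadd, hu, hκadd, hκsmul]; exact hB' t ht
  apply hAB
  rw [← hκadd, ← hκsmul, ← hκadd, ← hu, hιadd, hιadd, hιsmul]
  exact ((ha.add hb).add (hx.smul two_pos)).isUnit

section Lie

attribute [local instance 100] LieRing.ofAssociativeRing

variable {n : ℕ}

/-! ### The symplectic Lie algebra in blocks -/

theorem mem_spAlg_iff (X : Mat n) :
    X ∈ spAlg n ↔ Xᵀ * Matrix.J (Fin n) ℝ = Matrix.J (Fin n) ℝ * -X := by
  rw [spAlg, LieAlgebra.Symplectic.sp, mem_skewAdjointMatricesLieSubalgebra,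
    mem_skewAdjointMatricesSubmodule, Matrix.IsSkewAdjoint, Matrix.IsAdjointPair]

theorem fromBlocks_mem_spAlg_iff {A B C D : Matrix (Fin n) (Fin n) ℝ} :
    Matrix.fromBlocks A B C D ∈ spAlg n ↔ B.IsSymm ∧ C.IsSymm ∧ D = -Aᵀ := by
  rw [mem_spAlg_iff, Matrix.J,
    Matrix.fromBlocks_transpose, Matrix.fromBlocks_multiply, Matrix.fromBlocks_neg,
    Matrix.fromBlocks_multiply, Matrix.fromBlocks_inj]
  simp only [Matrix.mul_zero, Matrix.mul_one, zero_add, Matrix.mul_neg, add_zero, Matrix.zero_mul,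
    neg_neg, Matrix.neg_mul, Matrix.one_mul, neg_zero, neg_inj, Matrix.IsSymm]
  constructor
  · rintro ⟨h1, h2, h3, h4⟩
    exact ⟨h4, h1, h2.symm⟩
  · rintro ⟨h1, h2, h3⟩
    refine ⟨h2, h3.symm, ?_, h1⟩
    rw [h3]; simp

theorem coe_lie (X Y : spAlg n) : ((⁅X, Y⁆ : spAlg n) : Mat n) = X * Y - Y * X := by
  rw [LieSubalgebra.coe_bracket, LieRing.of_associative_ring_bracket]

/-- The element `(0 M; 0 0)` of `sp(2n, ℝ)`. -/
def upper (M : Matrix (Fin n) (Fin n) ℝ) (hM : M.IsSymm) : spAlg n :=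
  ⟨Matrix.fromBlocks 0 M 0 0, fromBlocks_mem_spAlg_iff.mpr ⟨hM, Matrix.isSymm_zero, by simp⟩⟩

/-- The element `(0 0; M 0)` of `sp(2n, ℝ)`. -/
def lower (M : Matrix (Fin n) (Fin n) ℝ) (hM : M.IsSymm) : spAlg n :=
  ⟨Matrix.fromBlocks 0 0 M 0, fromBlocks_mem_spAlg_iff.mpr ⟨Matrix.isSymm_zero, hM, by simp⟩⟩

/-- The element `(A 0; 0 -Aᵀ)` of `sp(2n, ℝ)`. -/
def levi (A : Matrix (Fin n) (Fin n) ℝ) : spAlg n :=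
  ⟨Matrix.fromBlocks A 0 0 (-Aᵀ),
    fromBlocks_mem_spAlg_iff.mpr ⟨Matrix.isSymm_zero, Matrix.isSymm_zero, rfl⟩⟩

theorem spAlg_blocks (X : spAlg n) : ∃ A B C : Matrix (Fin n) (Fin n) ℝ, B.IsSymm ∧ C.IsSymm ∧
    (X : Mat n) = Matrix.fromBlocks A B C (-Aᵀ) := by
  have h := Matrix.fromBlocks_toBlocks (X : Mat n)
  have hX := X.2
  rw [← h, fromBlocks_mem_spAlg_iff] at hX
  exact ⟨_, _, _, hX.1, hX.2.1, by rw [← hX.2.2, h]⟩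

theorem coe_inv_mul (g : Sp n) : ((g⁻¹ : Sp n) : Mat n) * (g : Mat n) = 1 := by
  rw [← Submonoid.coe_mul, inv_mul_cancel, Submonoid.coe_one]

theorem coe_mul_inv (g : Sp n) : (g : Mat n) * ((g⁻¹ : Sp n) : Mat n) = 1 := by
  rw [← Submonoid.coe_mul, mul_inv_cancel, Submonoid.coe_one]

theorem conj_mem_spAlg (g : Sp n) (X : spAlg n) :
    (g : Mat n) * (X : Mat n) * ((g⁻¹ : Sp n) : Mat n) ∈ spAlg n := by
  have hX := X.2
  rw [mem_spAlg_iff] at hX ⊢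
  have hg := SymplecticGroup.mem_iff'.mp (g⁻¹).2
  have hg1 : (((g⁻¹ : Sp n) : Mat n))ᵀ * Matrix.J (Fin n) ℝ =
      Matrix.J (Fin n) ℝ * (g : Mat n) := by
    calc (((g⁻¹ : Sp n) : Mat n))ᵀ * Matrix.J (Fin n) ℝ
        = (((g⁻¹ : Sp n) : Mat n))ᵀ * Matrix.J (Fin n) ℝ * (((g⁻¹ : Sp n) : Mat n) * g) := by
          rw [coe_inv_mul, Matrix.mul_one]
      _ = _ := by rw [← Matrix.mul_assoc, hg]
  have hg2 : ((g : Mat n))ᵀ * Matrix.J (Fin n) ℝ =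
      Matrix.J (Fin n) ℝ * ((g⁻¹ : Sp n) : Mat n) := by
    calc ((g : Mat n))ᵀ * Matrix.J (Fin n) ℝ
        = ((g : Mat n))ᵀ * Matrix.J (Fin n) ℝ * ((g : Mat n) * ((g⁻¹ : Sp n) : Mat n)) := by
          rw [coe_mul_inv, Matrix.mul_one]
      _ = _ := by rw [← Matrix.mul_assoc, SymplecticGroup.mem_iff'.mp g.2]
  calc ((g : Mat n) * (X : Mat n) * ((g⁻¹ : Sp n) : Mat n))ᵀ * Matrix.J (Fin n) ℝ
      = (((g⁻¹ : Sp n) : Mat n))ᵀ * ((X : Mat n)ᵀ * ((g : Mat n)ᵀ * Matrix.J (Fin n) ℝ)) := by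
        simp only [Matrix.transpose_mul, Matrix.mul_assoc]
    _ = (((g⁻¹ : Sp n) : Mat n))ᵀ * (((X : Mat n)ᵀ * Matrix.J (Fin n) ℝ) *
          ((g⁻¹ : Sp n) : Mat n)) := by rw [hg2, Matrix.mul_assoc]
    _ = ((((g⁻¹ : Sp n) : Mat n))ᵀ * Matrix.J (Fin n) ℝ) * (-(X : Mat n)) * ((g⁻¹ : Sp n) : Mat n) := by
        rw [hX]; simp only [Matrix.mul_assoc]
    _ = Matrix.J (Fin n) ℝ * -((g : Mat n) * (X : Mat n) * ((g⁻¹ : Sp n) : Mat n)) := by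
        rw [hg1]; simp only [Matrix.mul_assoc, Matrix.mul_neg, Matrix.neg_mul]

/-- The adjoint action of `Sp(2n, ℝ)` on its Lie algebra. -/
def Ad (g : Sp n) : spAlg n ≃ₗ⁅ℝ⁆ spAlg n where
  toFun X := ⟨(g : Mat n) * (X : Mat n) * ((g⁻¹ : Sp n) : Mat n), conj_mem_spAlg g X⟩
  map_add' X Y := by ext1; simp [Matrix.mul_add, Matrix.add_mul]
  map_smul' c X := by ext1; simp
  map_lie' := by
    intro X Y
    ext1
    simp only [coe_lie, Matrix.mul_sub, Matrix.sub_mul]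
    have h : ∀ A B : Mat n, (g : Mat n) * (A * B) * ((g⁻¹ : Sp n) : Mat n) =
        (g : Mat n) * A * ((g⁻¹ : Sp n) : Mat n) * ((g : Mat n) * B * ((g⁻¹ : Sp n) : Mat n)) := by
      intro A B
      calc (g : Mat n) * (A * B) * ((g⁻¹ : Sp n) : Mat n)
          = (g : Mat n) * A * 1 * (B * ((g⁻¹ : Sp n) : Mat n)) := by
            simp only [Matrix.mul_assoc, Matrix.one_mul]
        _ = _ := by rw [← coe_inv_mul g]; simp only [Matrix.mul_assoc]
    rw [h, h]
  invFun X := ⟨((g⁻¹ : Sp n) : Mat n) * X * (g : Mat n), by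
    have := conj_mem_spAlg g⁻¹ X
    rwa [inv_inv] at this⟩
  left_inv X := by
    ext1
    calc ((g⁻¹ : Sp n) : Mat n) * ((g : Mat n) * (X : Mat n) * ((g⁻¹ : Sp n) : Mat n)) * (g : Mat n)
        = (((g⁻¹ : Sp n) : Mat n) * (g : Mat n)) * X * (((g⁻¹ : Sp n) : Mat n) * (g : Mat n)) := by
          simp only [Matrix.mul_assoc]
      _ = X := by rw [coe_inv_mul]; simp
  right_inv X := by
    ext1
    calc (g : Mat n) * (((g⁻¹ : Sp n) : Mat n) * X * (g : Mat n)) * ((g⁻¹ : Sp n) : Mat n)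
        = ((g : Mat n) * ((g⁻¹ : Sp n) : Mat n)) * X * ((g : Mat n) * ((g⁻¹ : Sp n) : Mat n)) := by
          simp only [Matrix.mul_assoc]
      _ = X := by rw [coe_mul_inv]; simp

theorem coe_Ad (g : Sp n) (X : spAlg n) :
    (Ad g X : Mat n) = (g : Mat n) * (X : Mat n) * ((g⁻¹ : Sp n) : Mat n) := rfl

theorem Ad_mul (g h : Sp n) (X : spAlg n) : Ad (g * h) X = Ad g (Ad h X) := by
  ext1
  simp only [coe_Ad, _root_.mul_inv_rev, Submonoid.coe_mul, Matrix.mul_assoc]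

theorem Ad_one (X : spAlg n) : Ad 1 X = X := by
  ext1
  simp [coe_Ad]

theorem Ad_inv_Ad (g : Sp n) (X : spAlg n) : Ad g⁻¹ (Ad g X) = X := by
  rw [← Ad_mul, inv_mul_cancel, Ad_one]

theorem Ad_Ad_inv (g : Sp n) (X : spAlg n) : Ad g (Ad g⁻¹ X) = X := by
  rw [← Ad_mul, mul_inv_cancel, Ad_one]

/-! ### Parabolic subalgebras -/

theorem parabolicAlg_smul (g : Sp n) (x : Flag n) :
    parabolicAlg (g • x) = Ad g '' parabolicAlg x := by
  have key : ∀ (g : Sp n) (x : Flag n), Ad g '' parabolicAlg x ⊆ parabolicAlg (g • x) := by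
    rintro g x _ ⟨X, ⟨h, rfl, Y, hY, hX⟩, rfl⟩
    refine ⟨g * h, rfl, Y, hY, ?_⟩
    rw [coe_Ad, hX, _root_.mul_inv_rev]
    simp only [Submonoid.coe_mul, Matrix.mul_assoc]
  refine Set.Subset.antisymm ?_ (key g x)
  intro X hX
  refine ⟨Ad g⁻¹ X, ?_, Ad_Ad_inv g X⟩
  have := key g⁻¹ (g • x) ⟨X, hX, rfl⟩
  rwa [inv_smul_smul] at this

theorem mem_parabolicAlg_flagL (X : spAlg n) :
    X ∈ parabolicAlg (flagL n) ↔ (X : Mat n).toBlocks₂₁ = 0 := by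
  constructor
  · rintro ⟨g, hg, Y, hY, hX⟩
    have hg' : g ∈ parabolic n := by
      have := QuotientGroup.eq.mp (hg : (g : Flag n) = ((1 : Sp n) : Flag n))
      rw [mul_one] at this
      exact (Subgroup.inv_mem_iff _).mp this
    have hgi : g⁻¹ ∈ parabolic n := (parabolic n).inv_mem hg'
    have h1 : (g : Mat n).toBlocks₂₁ = 0 := hg'
    have h2 : ((g⁻¹ : Sp n) : Mat n).toBlocks₂₁ = 0 := hgi
    rw [hX, ← Matrix.fromBlocks_toBlocks (g : Mat n),
      ← Matrix.fromBlocks_toBlocks ((g⁻¹ : Sp n) : Mat n), ← Matrix.fromBlocks_toBlocks (Y : Mat n),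
      h1, h2, hY, Matrix.fromBlocks_multiply, Matrix.fromBlocks_multiply,
      Matrix.toBlocks_fromBlocks₂₁]
    simp
  · intro h
    exact ⟨1, rfl, X, h, by simp⟩

theorem mem_parabolicAlg_smul (g : Sp n) (x : Flag n) (X : spAlg n) :
    X ∈ parabolicAlg (g • x) ↔ Ad g⁻¹ X ∈ parabolicAlg x := by
  rw [parabolicAlg_smul]
  constructor
  · rintro ⟨Y, hY, rfl⟩
    rwa [Ad_inv_Ad]
  · intro h
    exact ⟨_, h, Ad_Ad_inv g X⟩

theorem smul_flagL (g : Sp n) : g • flagL n = (g : Flag n) := by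
  change ((g * 1 : Sp n) : Flag n) = _
  rw [mul_one]

theorem coe_Omega : (Omega n : Mat n) = Matrix.fromBlocks 0 1 (-1) 0 := by
  simp [Omega, Matrix.J, Matrix.fromBlocks_neg]

theorem coe_Omega_inv : (((Omega n)⁻¹ : Sp n) : Mat n) = Matrix.fromBlocks 0 (-1) 1 0 := by
  rw [SymplecticGroup.coe_inv, coe_Omega]
  simp [Matrix.J, Matrix.fromBlocks_neg, Matrix.fromBlocks_transpose, Matrix.fromBlocks_multiply]

theorem mem_parabolicAlg_flagLopp (X : spAlg n) :
    X ∈ parabolicAlg (flagLopp n) ↔ (X : Mat n).toBlocks₁₂ = 0 := by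
  rw [flagLopp, ← smul_flagL, mem_parabolicAlg_smul, mem_parabolicAlg_flagL, coe_Ad, inv_inv,
    coe_Omega, coe_Omega_inv, ← Matrix.fromBlocks_toBlocks (X : Mat n),
    Matrix.fromBlocks_multiply, Matrix.fromBlocks_multiply]
  simp

/-- The elements of `sp(2n, ℝ)` that bracket the whole algebra into `P`. For a parabolic subalgebra
of a Lagrangian this is its nilradical. -/
def nilSet (P : Set (spAlg n)) : Set (spAlg n) := {X | ∀ Y, ⁅X, Y⁆ ∈ P}

theorem nilSet_image (φ : spAlg n ≃ₗ⁅ℝ⁆ spAlg n) (P : Set (spAlg n)) (X : spAlg n) :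
    φ X ∈ nilSet (φ '' P) ↔ X ∈ nilSet P := by
  constructor
  · intro h Y
    obtain ⟨Z, hZ, hZ'⟩ := h (φ Y)
    rw [← LieEquiv.map_lie] at hZ'
    rwa [← φ.injective hZ']
  · intro h Y
    refine ⟨⁅X, φ.symm Y⁆, h _, ?_⟩
    rw [LieEquiv.map_lie, LieEquiv.apply_symm_apply]

theorem mem_nilSet_flagL (X : spAlg n) :
    X ∈ nilSet (parabolicAlg (flagL n)) ↔ ∃ M hM, X = upper M hM := by
  constructor
  · intro h
    obtain ⟨A, B, C, hB, hC, hX⟩ := spAlg_blocks X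
    have hC0 : C = 0 := by
      have := (mem_parabolicAlg_flagL _).mp (h (levi 1))
      rw [coe_lie, hX] at this
      simp [levi, Matrix.fromBlocks_multiply, sub_eq_add_neg, Matrix.fromBlocks_neg,
        Matrix.fromBlocks_add] at this
      ext i j
      have := congrFun (congrFun this i) j
      simp at this
      simpa using this
    have hA : ∀ G : Matrix (Fin n) (Fin n) ℝ, G.IsSymm → Aᵀ * G + G * A = 0 := by
      intro G hG
      have := (mem_parabolicAlg_flagL _).mp (h (lower G hG))
      rw [coe_lie, hX] at this
      simp [lower, Matrix.fromBlocks_multiply, sub_eq_add_neg, Matrix.fromBlocks_neg,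
        Matrix.fromBlocks_add] at this
      rw [← neg_eq_zero, ← this]
      abel
    have hA0 : A = 0 := by
      ext i j
      have h1 := hA (Matrix.single i i 1) (by simp [Matrix.IsSymm])
      have h2 := congrFun (congrFun h1 i) j
      simp [Matrix.mul_apply, Matrix.single_apply] at h2
      by_cases hij : i = j
      · subst hij
        simp at h2
        simpa using h2
      · simpa [hij] using h2
    refine ⟨B, hB, Subtype.ext ?_⟩
    rw [hX, hA0, hC0]
    simp [upper]
  · rintro ⟨M, hM, rfl⟩ Y
    obtain ⟨A, B, C, hB, hC, hY⟩ := spAlg_blocks Y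
    rw [mem_parabolicAlg_flagL, coe_lie, hY]
    simp [upper, Matrix.fromBlocks_multiply, sub_eq_add_neg, Matrix.fromBlocks_neg,
        Matrix.fromBlocks_add]

theorem coe_lie_lie_upper (M : Matrix (Fin n) (Fin n) ℝ) (hM : M.IsSymm) (Y : spAlg n) :
    ((⁅upper M hM, ⁅upper M hM, Y⁆⁆ : spAlg n) : Mat n) =
      Matrix.fromBlocks 0 ((-2 : ℝ) • (M * (Y : Mat n).toBlocks₂₁ * M)) 0 0 := by
  obtain ⟨A, B, C, hB, hC, hY⟩ := spAlg_blocks Y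
  rw [coe_lie, coe_lie, hY]
  simp [upper, Matrix.fromBlocks_multiply, sub_eq_add_neg, Matrix.fromBlocks_neg,
        Matrix.fromBlocks_add, Matrix.mul_assoc]
  rw [← neg_add, ← two_smul ℝ]

/-- Invertibility of `M` in terms of the Lie algebra structure. -/
theorem isUnit_iff_lie_lie (M : Matrix (Fin n) (Fin n) ℝ) (hM : M.IsSymm) :
    IsUnit M ↔ ∀ Z ∈ nilSet (parabolicAlg (flagL n)), ∃ Y, ⁅upper M hM, ⁅upper M hM, Y⁆⁆ = Z := by
  constructor
  · intro hu Z hZ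
    obtain ⟨N, hN, rfl⟩ := (mem_nilSet_flagL Z).mp hZ
    have hdet := (Matrix.isUnit_iff_isUnit_det M).mp hu
    refine ⟨lower ((-2 : ℝ)⁻¹ • (M⁻¹ * N * M⁻¹)) ?_, Subtype.ext ?_⟩
    · have : M⁻¹ᵀ = M⁻¹ := by rw [Matrix.transpose_nonsing_inv, hM.eq]
      simp [Matrix.IsSymm, Matrix.transpose_mul, this, hN.eq, Matrix.mul_assoc]
    · rw [coe_lie_lie_upper]
      simp only [upper, lower, Matrix.toBlocks_fromBlocks₂₁]
      congr 1
      rw [Matrix.mul_smul, Matrix.smul_mul, smul_smul]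
      rw [show (-2 : ℝ) * (-2)⁻¹ = 1 by norm_num, one_smul]
      calc M * (M⁻¹ * N * M⁻¹) * M = (M * M⁻¹) * N * (M⁻¹ * M) := by
            simp only [Matrix.mul_assoc]
        _ = N := by rw [Matrix.mul_nonsing_inv _ hdet, Matrix.nonsing_inv_mul _ hdet]; simp
  · intro h
    obtain ⟨Y, hY⟩ := h (upper 1 Matrix.isSymm_one) ((mem_nilSet_flagL _).mpr ⟨_, _, rfl⟩)
    have := congrArg (fun X : spAlg n => (X : Mat n).toBlocks₁₂) hY
    simp only [coe_lie_lie_upper, Matrix.toBlocks_fromBlocks₁₂] at this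
    change _ = (1 : Matrix (Fin n) (Fin n) ℝ) at this
    rw [Matrix.mul_assoc, ← Matrix.mul_smul] at this
    exact IsUnit.of_mul_eq_one _ this

theorem upper_add (M N : Matrix (Fin n) (Fin n) ℝ) (hM : M.IsSymm) (hN : N.IsSymm) :
    upper (M + N) (hM.add hN) = upper M hM + upper N hN := by
  ext1
  simp [upper, Matrix.fromBlocks_add]

/-- An automorphism of `sp(2n, ℝ)` that preserves the parabolic subalgebra of `L` maps the positive
definite elements of the nilradical to definite ones. -/
theorem exists_isDefinite_of_lieEquiv (φ : spAlg n ≃ₗ⁅ℝ⁆ spAlg n)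
    (hφ : φ '' parabolicAlg (flagL n) = parabolicAlg (flagL n))
    (M : Matrix (Fin n) (Fin n) ℝ) (hM : M.IsSymm) (hpos : M.PosDef) :
    ∃ N hN, φ (upper M hM) = upper N hN ∧ IsDefinite N := by
  have hnil : ∀ X, φ X ∈ nilSet (parabolicAlg (flagL n)) ↔ X ∈ nilSet (parabolicAlg (flagL n)) := by
    intro X
    have := nilSet_image φ (parabolicAlg (flagL n)) X
    rwa [hφ] at this
  let V : Submodule ℝ (spAlg n) :=
    { carrier := nilSet (parabolicAlg (flagL n))
      zero_mem' := (mem_nilSet_flagL _).mpr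
        ⟨0, Matrix.isSymm_zero, Subtype.ext (by simp [upper])⟩
      add_mem' := by
        intro a b ha hb
        obtain ⟨M, hM, rfl⟩ := (mem_nilSet_flagL _).mp ha
        obtain ⟨N, hN, rfl⟩ := (mem_nilSet_flagL _).mp hb
        exact (mem_nilSet_flagL _).mpr ⟨_, _, (upper_add M N hM hN).symm⟩
      smul_mem' := by
        intro c a ha
        obtain ⟨M, hM, rfl⟩ := (mem_nilSet_flagL _).mp ha
        exact (mem_nilSet_flagL _).mpr ⟨c • M, hM.smul c,
          Subtype.ext (by simp [upper, Matrix.fromBlocks_smul])⟩ }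
  have hunit : ∀ X : V, IsUnit ((X : spAlg n) : Mat n).toBlocks₁₂ ↔
      ∀ Z ∈ nilSet (parabolicAlg (flagL n)), ∃ Y, ⁅(X : spAlg n), ⁅(X : spAlg n), Y⁆⁆ = Z := by
    rintro ⟨X, hX⟩
    obtain ⟨M, hM, rfl⟩ := (mem_nilSet_flagL _).mp hX
    exact isUnit_iff_lie_lie M hM
  have hsymm : ∀ X ∈ nilSet (parabolicAlg (flagL n)), ((X : spAlg n) : Mat n).toBlocks₁₂.IsSymm := by
    intro X hX
    obtain ⟨M, hM, rfl⟩ := (mem_nilSet_flagL _).mp hX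
    exact hM
  have hmem : upper M hM ∈ nilSet (parabolicAlg (flagL n)) := (mem_nilSet_flagL _).mpr ⟨_, _, rfl⟩
  have := isDefinite_of_preserves_isUnit (V := V)
    (fun X => ((X : spAlg n) : Mat n).toBlocks₁₂)
    (fun X => (φ (X : spAlg n) : Mat n).toBlocks₁₂)
    (fun X Y => rfl) (fun c X => rfl)
    (fun X Y => by ext i j; simp [Matrix.toBlocks₁₂]) (fun c X => by ext i j; simp [Matrix.toBlocks₁₂])
    (fun X => hsymm _ X.2) (fun X => hsymm _ ((hnil _).mpr X.2))
    (fun A hA => ⟨⟨φ.symm (upper A hA), by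
      change _ ∈ nilSet (parabolicAlg (flagL n))
      rw [← hnil, LieEquiv.apply_symm_apply]; exact (mem_nilSet_flagL _).mpr ⟨_, _, rfl⟩⟩, by
      simp [upper]⟩)
    (fun X => by
      rw [hunit X, hunit ⟨φ X, (hnil _).mpr X.2⟩]
      constructor
      · intro h Z hZ
        obtain ⟨Y, hY⟩ := h (φ.symm Z) (by rw [← hnil, LieEquiv.apply_symm_apply]; exact hZ)
        refine ⟨φ Y, ?_⟩
        simp only [← LieEquiv.map_lie]
        rw [hY, LieEquiv.apply_symm_apply]
      · intro h Z hZ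
        obtain ⟨Y, hY⟩ := h (φ Z) ((hnil _).mpr hZ)
        refine ⟨φ.symm Y, φ.injective ?_⟩
        change φ _ = φ Z
        rw [← hY]
        simp only [LieEquiv.map_lie, LieEquiv.apply_symm_apply])
    (x := ⟨upper M hM, hmem⟩) (by simpa [upper] using hpos)
  obtain ⟨N, hN, h⟩ := (mem_nilSet_flagL _).mp ((hnil _).mpr hmem)
  refine ⟨N, hN, h, ?_⟩
  simp only [h] at this
  simpa [upper] using this

end Lie

section Chart

attribute [local instance 100] LieRing.ofAssociativeRing

variable {n : ℕ}

/-! ### The affine chart of Lagrangians transverse to `L` -/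

/-- The unipotent element `(1 S; 0 1)` of `Sp(2n, ℝ)`. -/
def uni (S : Matrix (Fin n) (Fin n) ℝ) (hS : S.IsSymm) : Sp n :=
  ⟨Matrix.fromBlocks 1 S 0 1, by
    rw [SymplecticGroup.fromBlocks_mem_iff]
    simp [hS.eq]⟩

theorem coe_uni (S : Matrix (Fin n) (Fin n) ℝ) (hS : S.IsSymm) :
    (uni S hS : Mat n) = Matrix.fromBlocks 1 S 0 1 := rfl

theorem uni_mul (S T : Matrix (Fin n) (Fin n) ℝ) (hS : S.IsSymm) (hT : T.IsSymm) :
    uni S hS * uni T hT = uni (S + T) (hS.add hT) := by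
  ext1
  simp [coe_uni, Matrix.fromBlocks_multiply, add_comm]

theorem uni_inv (S : Matrix (Fin n) (Fin n) ℝ) (hS : S.IsSymm) :
    (uni S hS)⁻¹ = uni (-S) hS.neg := by
  rw [inv_eq_iff_mul_eq_one]
  ext1
  simp [coe_uni, Matrix.fromBlocks_multiply]

theorem Ad_uni (S : Matrix (Fin n) (Fin n) ℝ) (hS : S.IsSymm) (X : spAlg n) :
    Ad (uni S hS) X = X + ⁅upper S hS, X⁆ + (1 / 2 : ℝ) • ⁅upper S hS, ⁅upper S hS, X⁆⁆ := by
  obtain ⟨A, B, C, hB, hC, hX⟩ := spAlg_blocks X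
  ext1
  simp only [AddMemClass.coe_add, SetLike.val_smul]
  rw [coe_lie_lie_upper, coe_lie, coe_Ad, uni_inv, hX]
  simp only [coe_uni, upper, Matrix.fromBlocks_multiply, sub_eq_add_neg, Matrix.fromBlocks_neg,
    Matrix.fromBlocks_add, Matrix.fromBlocks_smul, Matrix.toBlocks_fromBlocks₂₁, Matrix.fromBlocks_inj,
    smul_smul]
  refine ⟨by simp, ?_, by simp, by simp [add_comm]⟩
  simp only [Matrix.one_mul, Matrix.mul_one, Matrix.mul_neg, Matrix.add_mul, Matrix.zero_mul]
  norm_num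
  abel

/-- The flag of the Lagrangian that is the graph of `S` over `Lᵒᵖᵖ` determines `S`. -/
theorem uni_flagLopp_injective {S T : Matrix (Fin n) (Fin n) ℝ} (hS : S.IsSymm) (hT : T.IsSymm)
    (h : parabolicAlg (uni S hS • flagLopp n) = parabolicAlg (uni T hT • flagLopp n)) : S = T := by
  have h1 : Ad (uni T hT) (levi 1) ∈ parabolicAlg (uni S hS • flagLopp n) := by
    rw [h, parabolicAlg_smul]
    exact ⟨_, (mem_parabolicAlg_flagLopp _).mpr (by simp [levi]), rfl⟩
  rw [mem_parabolicAlg_smul, ← Ad_mul, uni_inv, uni_mul, mem_parabolicAlg_flagLopp, coe_Ad,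
    uni_inv] at h1
  simp [coe_uni, levi, Matrix.fromBlocks_multiply] at h1
  ext i j
  have := congrFun (congrFun h1 i) j
  simp at this
  linarith

theorem isUnit_toBlocks₂₁_of_transverse (h : Sp n)
    (ht : ∀ X ∈ nilSet (parabolicAlg (flagL n)), X ∈ parabolicAlg (h : Flag n) → X = 0) :
    IsUnit (h : Mat n).toBlocks₂₁ := by
  by_contra hcon
  rw [Matrix.isUnit_iff_isUnit_det, isUnit_iff_ne_zero, not_not] at hcon
  obtain ⟨v, hv0, hv⟩ := Matrix.exists_vecMul_eq_zero_iff.mpr hcon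
  have hsymm : (Matrix.vecMulVec v v).IsSymm := by
    rw [Matrix.IsSymm, Matrix.transpose_vecMulVec]
  have := ht (upper _ hsymm) ((mem_nilSet_flagL _).mpr ⟨_, _, rfl⟩) (by
    rw [← smul_flagL, mem_parabolicAlg_smul, mem_parabolicAlg_flagL, coe_Ad, inv_inv,
      SymplecticGroup.coe_inv]
    rw [← Matrix.fromBlocks_toBlocks (h : Mat n)]
    simp [Matrix.J, upper, Matrix.fromBlocks_multiply, Matrix.fromBlocks_transpose,
      Matrix.fromBlocks_neg, Matrix.mul_assoc, Matrix.vecMulVec_mul, hv])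
  have h2 := congrArg (fun X : spAlg n => (X : Mat n).toBlocks₁₂) this
  simp [upper] at h2
  apply hv0
  funext i
  have := congrFun (congrFun h2 i) i
  simpa [Matrix.vecMulVec_apply, Matrix.toBlocks₁₂] using this

/-- The coordinate of the affine chart of Lagrangians transverse to `L`. -/
def chartMat : Flag n → Matrix (Fin n) (Fin n) ℝ :=
  Quotient.lift (fun g : Sp n => (g : Mat n).toBlocks₁₁ * ((g : Mat n).toBlocks₂₁)⁻¹) (by
    intro g h hgh
    have hp : g⁻¹ * h ∈ parabolic n := QuotientGroup.leftRel_apply.mp hgh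
    obtain ⟨p, rfl⟩ : ∃ p, h = g * p := ⟨g⁻¹ * h, by rw [mul_inv_cancel_left]⟩
    rw [inv_mul_cancel_left] at hp
    have hp21 : (p : Mat n).toBlocks₂₁ = 0 := hp
    have hpi : ((p⁻¹ : Sp n) : Mat n).toBlocks₂₁ = 0 := (parabolic n).inv_mem hp
    have hone := coe_mul_inv p
    rw [← Matrix.fromBlocks_toBlocks (p : Mat n),
      ← Matrix.fromBlocks_toBlocks ((p⁻¹ : Sp n) : Mat n), hp21, hpi, Matrix.fromBlocks_multiply,
      ← Matrix.fromBlocks_one, Matrix.fromBlocks_inj] at hone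
    have h11 : (p : Mat n).toBlocks₁₁ * ((p⁻¹ : Sp n) : Mat n).toBlocks₁₁ = 1 := by
      simpa using hone.1
    have hu : IsUnit (p : Mat n).toBlocks₁₁.det :=
      (Matrix.isUnit_iff_isUnit_det _).mp (IsUnit.of_mul_eq_one _ h11)
    rw [Submonoid.coe_mul]
    conv_rhs => rw [← Matrix.fromBlocks_toBlocks (g : Mat n),
      ← Matrix.fromBlocks_toBlocks (p : Mat n), hp21, Matrix.fromBlocks_multiply]
    simp only [Matrix.mul_zero, add_zero, Matrix.toBlocks_fromBlocks₁₁,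
      Matrix.toBlocks_fromBlocks₂₁, Matrix.mul_inv_rev]
    rw [Matrix.mul_assoc, ← Matrix.mul_assoc (p : Mat n).toBlocks₁₁, Matrix.mul_nonsing_inv _ hu,
      Matrix.one_mul])

theorem chartMat_mk (g : Sp n) :
    chartMat (g : Flag n) = (g : Mat n).toBlocks₁₁ * ((g : Mat n).toBlocks₂₁)⁻¹ := rfl

theorem continuousAt_chartMat (g : Sp n) (hg : IsUnit (g : Mat n).toBlocks₂₁) :
    ContinuousAt chartMat (g : Flag n) := by
  have hq : IsOpenQuotientMap (QuotientGroup.mk : Sp n → Flag n) :=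
    QuotientGroup.isOpenQuotientMap_mk
  rw [← hq.continuousAt_comp_iff]
  change ContinuousAt
    (fun g : Sp n => (g : Mat n).toBlocks₁₁ * ((g : Mat n).toBlocks₂₁)⁻¹) g
  have h1 : Continuous fun g : Sp n => (g : Mat n).toBlocks₁₁ :=
    continuous_matrix fun i j => by
      simp only [Matrix.toBlocks₁₁, Matrix.of_apply]
      exact (continuous_subtype_val).matrix_elem _ _
  have h2 : Continuous fun g : Sp n => (g : Mat n).toBlocks₂₁ :=
    continuous_matrix fun i j => by
      simp only [Matrix.toBlocks₂₁, Matrix.of_apply]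
      exact (continuous_subtype_val).matrix_elem _ _
  have hdet : (g : Mat n).toBlocks₂₁.det ≠ 0 :=
    isUnit_iff_ne_zero.mp ((Matrix.isUnit_iff_isUnit_det _).mp hg)
  have h3 : ContinuousAt (fun g : Sp n => ((g : Mat n).toBlocks₂₁)⁻¹) g := by
    simp only [Matrix.inv_def, Ring.inverse_eq_inv']
    exact (ContinuousAt.inv₀ h2.matrix_det.continuousAt hdet).smul
      h2.matrix_adjugate.continuousAt
  exact h1.continuousAt.mul h3

theorem eq_uni_smul_flagLopp (g : Sp n) (hg : IsUnit (g : Mat n).toBlocks₂₁) :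
    ∃ hS : (chartMat (g : Flag n)).IsSymm,
      (g : Flag n) = uni (chartMat (g : Flag n)) hS • flagLopp n := by
  have hu := (Matrix.isUnit_iff_isUnit_det _).mp hg
  set a := (g : Mat n).toBlocks₁₁ with ha
  set c := (g : Mat n).toBlocks₂₁ with hc
  have hac : aᵀ * c = cᵀ * a := by
    have := g.2
    rw [← Matrix.fromBlocks_toBlocks (g : Mat n), SymplecticGroup.fromBlocks_mem_iff] at this
    exact this.1
  have hcS : cᵀ * (a * c⁻¹) = aᵀ := by
    rw [← Matrix.mul_assoc, ← hac, Matrix.mul_assoc, Matrix.mul_nonsing_inv _ hu, Matrix.mul_one]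
  have hS : (chartMat (g : Flag n)).IsSymm := by
    rw [chartMat_mk, ← ha, ← hc]
    have hut : IsUnit cᵀ.det := by rwa [Matrix.det_transpose]
    have : (a * c⁻¹) = (cᵀ)⁻¹ * aᵀ := by
      rw [← hcS, ← Matrix.mul_assoc, Matrix.nonsing_inv_mul _ hut, Matrix.one_mul]
    rw [Matrix.IsSymm, Matrix.transpose_mul, Matrix.transpose_nonsing_inv, ← this]
  refine ⟨hS, ?_⟩
  change (g : Flag n) = ((uni (chartMat (g : Flag n)) hS * Omega n : Sp n) : Flag n)
  rw [QuotientGroup.eq]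
  change ((g⁻¹ * (uni (chartMat (g : Flag n)) hS * Omega n) : Sp n) : Mat n).toBlocks₂₁ = 0
  rw [Submonoid.coe_mul, Submonoid.coe_mul, coe_uni, coe_Omega, SymplecticGroup.coe_inv,
    ← Matrix.fromBlocks_toBlocks (g : Mat n), chartMat_mk, ← ha, ← hc]
  simp [Matrix.J, Matrix.fromBlocks_multiply, Matrix.fromBlocks_transpose,
      Matrix.fromBlocks_neg, hcS]

/-- The relative position of a positive triple, in the chart of its first element. -/
theorem isDefinite_of_positive (g : Sp n) (φ : spAlg n ≃ₗ⁅ℝ⁆ spAlg n) (u : Sp n) (hu : u ∈ UPos n)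
    (h0 : parabolicAlg (g • flagL n) = φ '' parabolicAlg (flagL n))
    {S T : Matrix (Fin n) (Fin n) ℝ} (hS : S.IsSymm) (hT : T.IsSymm)
    (h1 : parabolicAlg (g • uni S hS • flagLopp n) = φ '' parabolicAlg (u • flagLopp n))
    (h2 : parabolicAlg (g • uni T hT • flagLopp n) = φ '' parabolicAlg (flagLopp n)) :
    IsDefinite (S - T) := by
  obtain ⟨M, hM, huM⟩ := hu
  have hMs : M.IsSymm := by
    have := hM.isHermitian
    rwa [Matrix.IsHermitian, Matrix.conjTranspose_eq_transpose_of_trivial] at this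
  obtain rfl : u = uni M hMs := Subtype.ext huM
  let ψ : spAlg n ≃ₗ⁅ℝ⁆ spAlg n := φ.trans (Ad g⁻¹)
  have hψ : ∀ x y, parabolicAlg (g • x) = φ '' parabolicAlg y →
      parabolicAlg x = ψ '' parabolicAlg y := by
    intro x y h
    have h3 : parabolicAlg x = Ad g⁻¹ '' parabolicAlg (g • x) := by
      rw [← parabolicAlg_smul, inv_smul_smul]
    rw [h3, h, Set.image_image]
    rfl
  obtain ⟨N, hN, hφN, hdef⟩ := exists_isDefinite_of_lieEquiv ψ (hψ _ _ h0).symm M hMs hM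
  have hconj : ∀ X, ψ (Ad (uni M hMs) X) = Ad (uni N hN) (ψ X) := by
    intro X
    rw [Ad_uni, Ad_uni]
    simp only [map_add, map_smul, LieEquiv.map_lie, hφN]
  have hSN : S = N + T := by
    refine uni_flagLopp_injective hS (hN.add hT) ?_
    rw [hψ _ _ h1, ← uni_mul _ _ hN hT, mul_smul, parabolicAlg_smul (uni N hN), hψ _ _ h2,
      parabolicAlg_smul, Set.image_image, Set.image_image]
    simp only [hconj]
  rw [hSN, add_sub_cancel_right]
  exact hdef

theorem isUnit_toBlocks₂₁_of_positive (g h : Sp n) (φ : spAlg n ≃ₗ⁅ℝ⁆ spAlg n)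
    (h0 : parabolicAlg (g • flagL n) = φ '' parabolicAlg (flagL n))
    (h2 : parabolicAlg (g • (h : Flag n)) = φ '' parabolicAlg (flagLopp n)) :
    IsUnit (h : Mat n).toBlocks₂₁ := by
  apply isUnit_toBlocks₂₁_of_transverse
  intro X hX hXh
  let ψ : spAlg n ≃ₗ⁅ℝ⁆ spAlg n := φ.trans (Ad g⁻¹)
  have hψ : ∀ x y, parabolicAlg (g • x) = φ '' parabolicAlg y →
      parabolicAlg x = ψ '' parabolicAlg y := by
    intro x y h
    have h3 : parabolicAlg x = Ad g⁻¹ '' parabolicAlg (g • x) := by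
      rw [← parabolicAlg_smul, inv_smul_smul]
    rw [h3, h, Set.image_image]
    rfl
  rw [hψ _ _ h2] at hXh
  obtain ⟨Y, hY, rfl⟩ := hXh
  rw [hψ _ _ h0, nilSet_image] at hX
  obtain ⟨M, hM, rfl⟩ := (mem_nilSet_flagL _).mp hX
  rw [mem_parabolicAlg_flagLopp] at hY
  have : M = 0 := by simpa [upper] using hY
  subst this
  have : upper (0 : Matrix (Fin n) (Fin n) ℝ) hM = 0 := Subtype.ext (by simp [upper])
  rw [this, map_zero]

/-! ### Cyclic order -/

theorem bdryCut_injective : Function.Injective bdryCut := by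
  intro x y h
  induction x using OnePoint.rec <;> induction y using OnePoint.rec <;>
    simp_all [bdryCut]

theorem exists_cyclicTriple {x₀ x : Bdry} (h : x ≠ x₀) : ∃ s, CyclicTriple x₀ s x := by
  induction x₀ using OnePoint.rec with
  | infty =>
    induction x using OnePoint.rec with
    | infty => exact absurd rfl h
    | coe t =>
      refine ⟨((t - 1 : ℝ) : Bdry), Or.inr (Or.inl ?_)⟩
      simp only [bdryCut, OnePoint.elim_some, OnePoint.elim_infty, WithTop.coe_lt_coe,
        WithTop.coe_lt_top, and_true]
      linarith
  | coe a =>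
    induction x using OnePoint.rec with
    | infty =>
      refine ⟨((a + 1 : ℝ) : Bdry), Or.inl ?_⟩
      simp only [bdryCut, OnePoint.elim_some, OnePoint.elim_infty, WithTop.coe_lt_coe,
        WithTop.coe_lt_top, and_true]
      linarith
    | coe t =>
      have hta : t ≠ a := fun h' => h (by rw [h'])
      rcases lt_or_gt_of_ne hta with hlt | hgt
      · refine ⟨((t - 1 : ℝ) : Bdry), Or.inr (Or.inl ?_)⟩
        simp only [bdryCut, OnePoint.elim_some, WithTop.coe_lt_coe]
        exact ⟨by linarith, hlt⟩
      · refine ⟨(((a + t) / 2 : ℝ) : Bdry), Or.inl ?_⟩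
        simp only [bdryCut, OnePoint.elim_some, WithTop.coe_lt_coe]
        constructor <;> linarith

theorem cyclicTriple_or {x₀ x y : Bdry} (hx : x ≠ x₀) (hy : y ≠ x₀) (hxy : x ≠ y) :
    CyclicTriple x₀ x y ∨ CyclicTriple x₀ y x := by
  have h1 := lt_or_gt_of_ne (bdryCut_injective.ne hx)
  have h2 := lt_or_gt_of_ne (bdryCut_injective.ne hy)
  have h3 := lt_or_gt_of_ne (bdryCut_injective.ne hxy)
  unfold CyclicTriple
  tauto

theorem CyclicTriple.ne {x₀ s t : Bdry} (h : CyclicTriple x₀ s t) : s ≠ x₀ ∧ t ≠ x₀ := by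
  constructor
  · rintro rfl
    rcases h with h | h | h
    · exact lt_irrefl _ h.1
    · exact lt_irrefl _ (h.1.trans h.2)
    · exact lt_irrefl _ h.2
  · rintro rfl
    rcases h with h | h | h
    · exact lt_irrefl _ (h.1.trans h.2)
    · exact lt_irrefl _ h.2
    · exact lt_irrefl _ h.1

/-- The maps that send cyclically ordered triples to positive triples, in the chart at `ξ(x₀)`. -/
theorem exists_chart {ξ : Bdry → Flag n} (hc : Continuous ξ)
    (hpos : ∀ x : Fin 3 → Bdry, CyclicallyOrdered x → IsPositiveTuple (fun i => ξ (x i)))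
    (x₀ : Bdry) :
    ∃ (g : Sp n) (S : Bdry → Matrix (Fin n) (Fin n) ℝ),
      (∀ x, x ≠ x₀ → ContinuousAt S x ∧ ∃ hS : (S x).IsSymm,
        ξ x = (g * uni (S x) hS) • flagLopp n) ∧
      ∀ x y, x ≠ x₀ → y ≠ x₀ → x ≠ y → IsDefinite (S x - S y) := by
  obtain ⟨g, hg⟩ := QuotientGroup.mk_surjective (ξ x₀)
  have hg0 : ξ x₀ = g • flagL n := by rw [smul_flagL]; exact hg.symm
  have htriple : ∀ s t, CyclicTriple x₀ s t → ∃ (φ : spAlg n ≃ₗ⁅ℝ⁆ spAlg n) (u : Sp n),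
      u ∈ UPos n ∧ parabolicAlg (g • flagL n) = φ '' parabolicAlg (flagL n) ∧
      parabolicAlg (ξ s) = φ '' parabolicAlg (u • flagLopp n) ∧
      parabolicAlg (ξ t) = φ '' parabolicAlg (flagLopp n) := by
    intro s t h
    obtain ⟨φ, u, hu, hφ⟩ := hpos ![x₀, s, t] (by
      intro i j k hij hjk
      obtain ⟨rfl, rfl, rfl⟩ : i = 0 ∧ j = 1 ∧ k = 2 := by omega
      exact h)
    refine ⟨φ, u 0, hu 0, ?_, ?_, ?_⟩
    · rw [← hg0]
      exact hφ 0
    · have := hφ 1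
      simpa [stdTuple] using this
    · have := hφ 2
      simpa [stdTuple] using this
  let S : Bdry → Matrix (Fin n) (Fin n) ℝ := fun x => chartMat (g⁻¹ • ξ x)
  have hunit : ∀ x, x ≠ x₀ → ∃ h : Sp n, g⁻¹ • ξ x = (h : Flag n) ∧
      IsUnit (h : Mat n).toBlocks₂₁ := by
    intro x hx
    obtain ⟨h, hh⟩ := QuotientGroup.mk_surjective (g⁻¹ • ξ x)
    obtain ⟨s, hs⟩ := exists_cyclicTriple hx
    obtain ⟨φ, u, hu, h0, h1, h2⟩ := htriple s x hs
    refine ⟨h, hh.symm, isUnit_toBlocks₂₁_of_positive g h φ h0 ?_⟩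
    rw [← h2]
    congr 1
    rw [show (h : Flag n) = g⁻¹ • ξ x from hh, smul_inv_smul]
  have hchart : ∀ x, x ≠ x₀ → ∃ hS : (S x).IsSymm, ξ x = g • uni (S x) hS • flagLopp n := by
    intro x hx
    obtain ⟨h, hh, hu⟩ := hunit x hx
    obtain ⟨hS, hS'⟩ := eq_uni_smul_flagLopp h hu
    have hSx : S x = chartMat (h : Flag n) := by simp only [S, hh]
    refine ⟨by rw [hSx]; exact hS, ?_⟩
    simp only [hSx]
    rw [← hS', ← hh, smul_inv_smul]
  have hcyc : ∀ s t, CyclicTriple x₀ s t → IsDefinite (S s - S t) := by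
    intro s t h
    obtain ⟨φ, u, hu, h0, h1, h2⟩ := htriple s t h
    obtain ⟨hSs, hs⟩ := hchart s h.ne.1
    obtain ⟨hSt, ht⟩ := hchart t h.ne.2
    rw [hs] at h1
    rw [ht] at h2
    exact isDefinite_of_positive g φ u hu h0 hSs hSt h1 h2
  refine ⟨g, S, ?_, ?_⟩
  · intro x hx
    obtain ⟨hS, hx'⟩ := hchart x hx
    refine ⟨?_, hS, by rw [mul_smul]; exact hx'⟩
    obtain ⟨h, hh, hu⟩ := hunit x hx
    have h1 : ContinuousAt chartMat (g⁻¹ • ξ x) := by rw [hh]; exact continuousAt_chartMat h hu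
    exact ContinuousAt.comp (f := fun x => g⁻¹ • ξ x) h1 (hc.const_smul g⁻¹).continuousAt
  · intro x y hx hy hxy
    rcases cyclicTriple_or hx hy hxy with h | h
    · exact hcyc _ _ h
    · have := (hcyc _ _ h).neg
      rwa [neg_sub] at this

end Chart

section Wedge

variable {n : ℕ}

/-! ### The Plücker embedding in the affine chart -/

/-- The vectors `(S eᵢ, eᵢ)`, whose span is the graph of `S` over `Lᵒᵖᵖ`. -/
def graphVec (S : Fin n → Fin n → ℝ) (i : Fin n) : Std n :=
  Sum.elim (fun j => S j i) (Pi.single i 1)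

/-- The coordinates of the decomposable `n`-vector of `g` applied to the graph of `S`. -/
def pluckVec (g : Sp n) (S : Fin n → Fin n → ℝ) : WedgeEuc n :=
  wedgeCoord n (exteriorPower.ιMulti ℝ n (fun i => (g : Mat n) *ᵥ graphVec S i))

theorem wedgeCoord_symm_pluckVec (g : Sp n) (S : Fin n → Fin n → ℝ) :
    (wedgeCoord n).symm (pluckVec g S) =
      exteriorPower.ιMulti ℝ n (fun i => (g : Mat n) *ᵥ graphVec S i) := by
  rw [pluckVec, LinearEquiv.symm_apply_apply]

theorem plucker_submodule_map (g : Sp n) (S : Matrix (Fin n) (Fin n) ℝ) (hS : S.IsSymm) :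
    (plucker ((g * uni S hS) • flagLopp n)).submodule.map (wedgeCoord n).toLinearMap =
      Submodule.span ℝ {pluckVec g fun i j => S i j} := by
  have h1 : wedgeRep ((g * uni S hS) * Omega n) (wedgeBase n) =
      ((-1 : ℝ) ^ n) • exteriorPower.ιMulti ℝ n (fun i => (g : Mat n) *ᵥ graphVec (fun i j => S i j) i) := by
    rw [wedgeRep, wedgeBase, exteriorPower.map_apply_ιMulti]
    have h2 : (fun i : Fin n => Matrix.mulVecLin (((g * uni S hS) * Omega n : Sp n) : Mat n)
        (Pi.single (Sum.inl i) 1 : Std n)) =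
        fun i => (fun _ => (-1 : ℝ)) i • ((g : Mat n) *ᵥ graphVec (fun i j => S i j) i) := by
      funext i
      have h3 : ((uni S hS : Mat n) * (Omega n : Mat n)) *ᵥ (Pi.single (Sum.inl i) 1 : Std n) =
          (-1 : ℝ) • graphVec (fun i j => S i j) i := by
        rw [coe_uni, coe_Omega, Matrix.fromBlocks_multiply]
        funext j
        cases j with
        | inl j => simp [graphVec]
        | inr j => by_cases h : j = i <;> simp [graphVec, h]
      rw [Matrix.mulVecLin_apply, Submonoid.coe_mul, Submonoid.coe_mul, Matrix.mul_assoc,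
        ← Matrix.mulVec_mulVec, h3, Matrix.mulVec_smul]
    change exteriorPower.ιMulti ℝ n (fun i : Fin n => Matrix.mulVecLin _ _) = _
    rw [h2, AlternatingMap.map_smul_univ]
    simp
  have h4 : (plucker ((g * uni S hS) • flagLopp n)).submodule =
      Submodule.span ℝ {wedgeRep ((g * uni S hS) * Omega n) (wedgeBase n)} :=
    Projectivization.submodule_mk _ _
  have hu : IsUnit ((-1 : ℝ) ^ n) := (isUnit_one.neg).pow n
  rw [h4, h1, Submodule.span_singleton_smul_eq hu, Submodule.map_span, Set.image_singleton]
  rfl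

theorem pluckVec_apply (g : Sp n) (S : Fin n → Fin n → ℝ)
    (s : Set.powersetCard (Fin (n + n)) n) :
    pluckVec g S s = (Matrix.of fun i j => (stdBasis n).coord
      (Set.powersetCard.ofFinEmbEquiv.symm s j) ((g : Mat n) *ᵥ graphVec S i)).det := by
  rw [← exteriorPower.ιMultiDual_apply_ιMulti, ← exteriorPower.basis_repr_apply]
  rfl

theorem contDiff_pluckVec (g : Sp n) : ContDiff ℝ 1 (pluckVec g) := by
  rw [contDiff_euclidean]
  intro s
  simp only [pluckVec_apply, Matrix.det_apply, Matrix.of_apply]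
  refine ContDiff.sum fun σ _ => ContDiff.const_smul _ (contDiff_prod fun i _ => ?_)
  have h1 : ∀ i, ContDiff ℝ 1 fun S : Fin n → Fin n → ℝ => graphVec S i := by
    intro i
    rw [contDiff_pi]
    intro j
    cases j with
    | inl j =>
      simp only [graphVec, Sum.elim_inl]
      fun_prop
    | inr j =>
      simp only [graphVec, Sum.elim_inr]
      exact contDiff_const
  have h2 : ∀ k, ContDiff ℝ 1 fun v : Std n =>
      (stdBasis n).coord k ((g : Mat n) *ᵥ v) := by
    intro k
    exact ((((stdBasis n).coord k).comp (Matrix.mulVecLin (g : Mat n))).toContinuousLinearMap).contDiff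
  exact (h2 _).comp (h1 _)

/-- The linear form on `⋀ⁿ ℝ²ⁿ` that is the determinant of the images under `L ∘ g⁻¹`. -/
def detForm (g : Sp n) (L : Std n →ₗ[ℝ] (Fin n → ℝ)) : WedgeEuc n →ₗ[ℝ] ℝ :=
  (exteriorPower.alternatingMapLinearEquiv ((Pi.basisFun ℝ (Fin n)).det.compLinearMap
    (L ∘ₗ Matrix.mulVecLin ((g⁻¹ : Sp n) : Mat n)))) ∘ₗ (wedgeCoord n).symm.toLinearMap

theorem detForm_pluckVec (g : Sp n) (L : Std n →ₗ[ℝ] (Fin n → ℝ)) (S : Fin n → Fin n → ℝ) :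
    detForm g L (pluckVec g S) = (Matrix.of fun i => L (graphVec S i)).det := by
  rw [detForm, LinearMap.comp_apply]
  change exteriorPower.alternatingMapLinearEquiv _ ((wedgeCoord n).symm (pluckVec g S)) = _
  rw [wedgeCoord_symm_pluckVec, exteriorPower.alternatingMapLinearEquiv_apply_ιMulti,
    AlternatingMap.compLinearMap_apply, Pi.basisFun_det]
  congr 1
  funext i
  change L (((g⁻¹ : Sp n) : Mat n) *ᵥ ((g : Mat n) *ᵥ graphVec S i)) = _
  rw [Matrix.mulVec_mulVec, coe_inv_mul, Matrix.one_mulVec]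
  rfl

/-- There is a linear form that equals `1` on the affine chart. -/
theorem exists_form_eq_one (g : Sp n) :
    ∃ μ : WedgeEuc n →ₗ[ℝ] ℝ, ∀ S, μ (pluckVec g S) = 1 := by
  refine ⟨detForm g (LinearMap.funLeft ℝ ℝ Sum.inr), fun S => ?_⟩
  rw [detForm_pluckVec]
  convert Matrix.det_one (n := Fin n) (R := ℝ)
  ext i j
  simp [LinearMap.funLeft_apply, graphVec, Matrix.one_apply, Pi.single_apply, eq_comm]

/-- There is a linear form that equals the trace on the affine chart. -/
theorem exists_form_eq_trace (g : Sp n) :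
    ∃ μ : WedgeEuc n →ₗ[ℝ] ℝ, ∀ S, μ (pluckVec g S) = ∑ i, S i i := by
  let L : Fin n → (Std n →ₗ[ℝ] (Fin n → ℝ)) := fun i =>
    LinearMap.funLeft ℝ ℝ (fun k => if k = i then Sum.inl i else Sum.inr k)
  refine ⟨∑ i, detForm g (L i), fun S => ?_⟩
  rw [LinearMap.sum_apply]
  refine Finset.sum_congr rfl fun i _ => ?_
  rw [detForm_pluckVec]
  have h : (Matrix.of fun j => L i (graphVec S j)) =
      (1 : Matrix (Fin n) (Fin n) ℝ).updateCol i (S i) := by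
    ext j k
    by_cases hk : k = i
    · subst hk
      simp [L, LinearMap.funLeft_apply, graphVec]
    · simp [L, LinearMap.funLeft_apply, graphVec, hk, Matrix.one_apply, Pi.single_apply,
        @eq_comm _ k j]
  rw [h, ← Matrix.cramer_apply, Matrix.cramer_one]
  rfl

/-- The form `ω'` in coordinates. -/
def omegaE (n : ℕ) : WedgeEuc n →ₗ[ℝ] WedgeEuc n →ₗ[ℝ] ℝ :=
  (omega' n).compl₁₂ (wedgeCoord n).symm.toLinearMap (wedgeCoord n).symm.toLinearMap

theorem omegaE_apply (v w : WedgeEuc n) :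
    omegaE n v w = omega' n ((wedgeCoord n).symm v) ((wedgeCoord n).symm w) := rfl

theorem omega'_ιMulti (a b : Fin n → Std n) :
    omega' n (exteriorPower.ιMulti ℝ n a) (exteriorPower.ιMulti ℝ n b) =
      (Matrix.of (Sum.elim a b)).det := by
  have h1 : wedgeMul (exteriorPower.ιMulti ℝ n a) (exteriorPower.ιMulti ℝ n b) =
      exteriorPower.ιMulti ℝ (n + n) (Fin.append a b) := by
    ext1
    exact ExteriorAlgebra.ιMulti_mul_ιMulti a b
  change volForm n (wedgeMul _ _) = _
  rw [h1, volForm, exteriorPower.alternatingMapLinearEquiv_apply_ιMulti, stdBasis,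
    Module.Basis.det_reindex, Pi.basisFun_det]
  congr 1
  funext i
  cases i with
  | inl i => exact Fin.append_left a b i
  | inr i => exact Fin.append_right a b i

theorem omegaE_pluckVec (g : Sp n) (S T : Fin n → Fin n → ℝ) :
    omegaE n (pluckVec g S) (pluckVec g T) = (Matrix.of S - Matrix.of T).det := by
  rw [omegaE_apply, wedgeCoord_symm_pluckVec, wedgeCoord_symm_pluckVec, omega'_ιMulti,
    ← Matrix.det_transpose]
  have h : (Matrix.of (Sum.elim (fun i => (g : Mat n) *ᵥ graphVec S i)
      (fun i => (g : Mat n) *ᵥ graphVec T i)))ᵀ =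
      (g : Mat n) * Matrix.fromBlocks (Matrix.of S) (Matrix.of T) 1 1 := by
    ext i j
    rw [Matrix.transpose_apply, Matrix.of_apply, Matrix.mul_apply]
    cases j with
    | inl j =>
      rw [Sum.elim_inl, Matrix.mulVec, dotProduct]
      refine Finset.sum_congr rfl fun k _ => ?_
      cases k <;> simp [graphVec, Matrix.one_apply, Pi.single_apply]
    | inr j =>
      rw [Sum.elim_inr, Matrix.mulVec, dotProduct]
      refine Finset.sum_congr rfl fun k _ => ?_
      cases k <;> simp [graphVec, Matrix.one_apply, Pi.single_apply]
  rw [h, Matrix.det_mul, SymplecticGroup.det_eq_one g.2, one_mul, Matrix.det_fromBlocks_one₂₂,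
    Matrix.mul_one]

end Wedge

/-! ### Orthogonal projections onto lines and planes -/

section Proj

variable {E : Type*} [NormedAddCommGroup E] [InnerProductSpace ℝ E]

/-- The orthogonal projection onto the line of `v`. -/
def lineProj (v : E) : E →L[ℝ] E := (Submodule.span ℝ {v}).starProjection

theorem lineProj_self (v : E) : lineProj v v = v :=
  Submodule.starProjection_eq_self_iff.mpr (Submodule.mem_span_singleton_self v)

theorem lineProj_mem (v x : E) : ∃ c : ℝ, lineProj v x = c • v := by
  obtain ⟨c, hc⟩ := Submodule.mem_span_singleton.mp
    (Submodule.starProjection_apply_mem (Submodule.span ℝ {v}) x)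
  exact ⟨c, hc.symm⟩

theorem norm_lineProj_le (v x : E) : ‖lineProj v x‖ ≤ ‖x‖ :=
  Submodule.norm_starProjection_apply_le _ x

theorem inner_sub_lineProj (v x : E) : inner ℝ v (x - lineProj v x) = 0 :=
  (real_inner_comm _ _).trans (Submodule.starProjection_inner_eq_zero (K := Submodule.span ℝ {v}) x v
    (Submodule.mem_span_singleton_self v))

theorem norm_sub_lineProj_le (v x : E) : ‖x - lineProj v x‖ ≤ ‖x‖ := by
  have h := inner_sub_lineProj v x
  obtain ⟨c, hc⟩ := lineProj_mem v x
  have h1 : inner ℝ (lineProj v x) (x - lineProj v x) = 0 := by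
    conv_lhs => rw [hc, inner_smul_left, ← hc]
    rw [h, mul_zero]
  have h2 : ‖x‖ * ‖x‖ = ‖lineProj v x‖ * ‖lineProj v x‖ +
      ‖x - lineProj v x‖ * ‖x - lineProj v x‖ := by
    have := norm_add_sq_eq_norm_sq_add_norm_sq_of_inner_eq_zero _ _ h1
    rwa [add_sub_cancel] at this
  nlinarith [norm_nonneg x, norm_nonneg (x - lineProj v x), norm_nonneg (lineProj v x)]

theorem norm_lineProj_sub_le {v w : E} {r : ℝ} (hr : 0 < r) (hv : r ≤ ‖v‖) (hw : r ≤ ‖w‖) :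
    ‖lineProj v - lineProj w‖ ≤ 2 / r * ‖v - w‖ := by
  refine ContinuousLinearMap.opNorm_le_bound _ (by positivity) fun x => ?_
  have h1 : ‖lineProj v x - lineProj w (lineProj v x)‖ ≤ ‖v - w‖ / r * ‖x‖ := by
    obtain ⟨c, hc⟩ := lineProj_mem v x
    have e : lineProj v x - lineProj w (lineProj v x) =
        c • ((v - w) - lineProj w (v - w)) := by
      rw [hc, map_smul, map_sub, lineProj_self w, ← smul_sub]
      congr 1
      abel
    have h2 : |c| * r ≤ ‖x‖ := by
      calc |c| * r ≤ |c| * ‖v‖ := by gcongr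
        _ = ‖lineProj v x‖ := by rw [hc, norm_smul, Real.norm_eq_abs]
        _ ≤ ‖x‖ := norm_lineProj_le v x
    rw [e, norm_smul, Real.norm_eq_abs]
    calc |c| * ‖(v - w) - lineProj w (v - w)‖ ≤ |c| * ‖v - w‖ := by
          gcongr; exact norm_sub_lineProj_le _ _
      _ = (|c| * r) * (‖v - w‖ / r) := by field_simp
      _ ≤ ‖x‖ * (‖v - w‖ / r) := by gcongr
      _ = _ := mul_comm _ _
  have h3 : ‖lineProj w (x - lineProj v x)‖ ≤ ‖v - w‖ / r * ‖x‖ := by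
    set z := x - lineProj v x with hz
    obtain ⟨c, hc⟩ := lineProj_mem w z
    have e1 : inner ℝ w (lineProj w z) = inner ℝ (w - v) z := by
      have e2 := inner_sub_lineProj w z
      have e3 := inner_sub_lineProj v x
      rw [inner_sub_right] at e2
      rw [inner_sub_left]
      rw [← hz] at e3
      linarith
    have e4 : ‖w‖ * ‖lineProj w z‖ ≤ ‖v - w‖ * ‖x‖ := by
      have : ‖w‖ * ‖lineProj w z‖ = |inner ℝ w (lineProj w z)| := by
        rw [hc, inner_smul_right, norm_smul, real_inner_self_eq_norm_sq, abs_mul,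
          abs_of_nonneg (sq_nonneg ‖w‖), Real.norm_eq_abs]
        ring
      rw [this, e1]
      calc |inner ℝ (w - v) z| ≤ ‖w - v‖ * ‖z‖ := abs_real_inner_le_norm _ _
        _ ≤ ‖v - w‖ * ‖x‖ := by
          rw [norm_sub_rev]; gcongr; exact norm_sub_lineProj_le _ _
    have e5 : r * ‖lineProj w z‖ ≤ ‖v - w‖ * ‖x‖ :=
      (mul_le_mul_of_nonneg_right hw (norm_nonneg _)).trans e4
    rw [div_mul_eq_mul_div, le_div_iff₀ hr]
    linarith
  have e : (lineProj v - lineProj w) x =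
      (lineProj v x - lineProj w (lineProj v x)) - lineProj w (x - lineProj v x) := by
    simp only [_root_.sub_apply, map_sub]
    abel
  rw [e]
  calc _ ≤ _ := norm_sub_le _ _
    _ ≤ ‖v - w‖ / r * ‖x‖ + ‖v - w‖ / r * ‖x‖ := add_le_add h1 h3
    _ = _ := by ring

/-- On an affine hyperplane that avoids the origin, vectors depend in a Lipschitz way on their
lines. -/
theorem norm_sub_le_lineProj (μ : E →L[ℝ] ℝ) {v w : E} (hv : μ v = 1) (hw : μ w = 1) {R : ℝ}
    (hvR : ‖v‖ ≤ R) (hwR : ‖w‖ ≤ R) :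
    ‖v - w‖ ≤ (R + ‖μ‖ * R * R) * ‖lineProj v - lineProj w‖ := by
  obtain ⟨c, hc⟩ := lineProj_mem w v
  have hR : 0 ≤ R := (norm_nonneg v).trans hvR
  have h1 : ‖v - c • w‖ ≤ R * ‖lineProj v - lineProj w‖ := by
    have : v - c • w = (lineProj v - lineProj w) v := by
      rw [_root_.sub_apply, lineProj_self, hc]
    rw [this, mul_comm]
    exact ((lineProj v - lineProj w).le_opNorm v).trans (by gcongr)
  have h2 : |1 - c| ≤ ‖μ‖ * (R * ‖lineProj v - lineProj w‖) := by
    have : 1 - c = μ (v - c • w) := by simp [hv, hw]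
    rw [this, ← Real.norm_eq_abs]
    exact (μ.le_opNorm _).trans (by gcongr)
  have h3 : v - w = (v - c • w) - (1 - c) • w := by
    rw [sub_smul, one_smul]; abel
  rw [h3]
  calc _ ≤ ‖v - c • w‖ + ‖(1 - c) • w‖ := norm_sub_le _ _
    _ ≤ R * ‖lineProj v - lineProj w‖ + (‖μ‖ * (R * ‖lineProj v - lineProj w‖)) * R := by
      rw [norm_smul, Real.norm_eq_abs]
      gcongr
    _ = _ := by ring

theorem tendsto_lineProj {α : Type*} {l : Filter α} {f : α → E} {u : E} (hu : u ≠ 0)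
    (hf : Tendsto f l (𝓝 u)) : Tendsto (fun a => lineProj (f a)) l (𝓝 (lineProj u)) := by
  rw [tendsto_iff_norm_sub_tendsto_zero] at hf ⊢
  have hu' : 0 < ‖u‖ := norm_pos_iff.mpr hu
  have hev : ∀ᶠ a in l, ‖f a - u‖ < ‖u‖ / 2 := hf.eventually_lt_const (by positivity)
  refine squeeze_zero' (Eventually.of_forall fun _ => norm_nonneg _) (?_ : ∀ᶠ a in l,
    ‖lineProj (f a) - lineProj u‖ ≤ 2 / (‖u‖ / 2) * ‖f a - u‖) ?_
  · filter_upwards [hev] with a ha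
    refine norm_lineProj_sub_le (by positivity) ?_ (by linarith)
    have := norm_sub_norm_le u (f a)
    rw [norm_sub_rev] at this
    linarith
  · simpa using hf.const_mul (2 / (‖u‖ / 2))

theorem starProjection_span_pair [FiniteDimensional ℝ E] (a b : E) :
    (Submodule.span ℝ {a} ⊔ Submodule.span ℝ {b}).starProjection =
      lineProj a + lineProj (b - lineProj a b) := by
  ext x
  set u := b - lineProj a b with hu
  obtain ⟨c, hc⟩ := lineProj_mem a b
  have hau : inner ℝ a u = 0 := inner_sub_lineProj a b
  apply Submodule.eq_starProjection_of_mem_of_inner_eq_zero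
  · have ha : a ∈ Submodule.span ℝ {a} ⊔ Submodule.span ℝ {b} :=
      Submodule.mem_sup_left (Submodule.mem_span_singleton_self a)
    have hb : b ∈ Submodule.span ℝ {a} ⊔ Submodule.span ℝ {b} :=
      Submodule.mem_sup_right (Submodule.mem_span_singleton_self b)
    have hmu : u ∈ Submodule.span ℝ {a} ⊔ Submodule.span ℝ {b} := by
      rw [hu, hc]; exact Submodule.sub_mem _ hb (Submodule.smul_mem _ _ ha)
    obtain ⟨d, hd⟩ := lineProj_mem a x
    obtain ⟨e, he⟩ := lineProj_mem u x
    rw [_root_.add_apply, hd, he]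
    exact Submodule.add_mem _ (Submodule.smul_mem _ _ ha) (Submodule.smul_mem _ _ hmu)
  · have h1 := inner_sub_lineProj a x
    have h2 := inner_sub_lineProj u x
    obtain ⟨d, hd⟩ := lineProj_mem a x
    obtain ⟨e, he⟩ := lineProj_mem u x
    have hia : inner ℝ a (x - (lineProj a + lineProj u) x) = 0 := by
      rw [_root_.add_apply, ← sub_sub, inner_sub_right, h1, he, inner_smul_right, hau]
      simp
    have hiu : inner ℝ u (x - (lineProj a + lineProj u) x) = 0 := by
      rw [_root_.add_apply, add_comm, ← sub_sub, inner_sub_right, h2, hd,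
        inner_smul_right, real_inner_comm, hau]
      simp
    have hib : inner ℝ b (x - (lineProj a + lineProj u) x) = 0 := by
      have : b = u + c • a := by rw [hu, hc]; abel
      conv_lhs => rw [this, inner_add_left, inner_smul_left]
      rw [hia, hiu]
      simp
    intro w hw
    obtain ⟨y, hy, z, hz, rfl⟩ := Submodule.mem_sup.mp hw
    obtain ⟨α, rfl⟩ := Submodule.mem_span_singleton.mp hy
    obtain ⟨β, rfl⟩ := Submodule.mem_span_singleton.mp hz
    rw [real_inner_comm, inner_add_left, inner_smul_left, inner_smul_left, hia, hib]
    simp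

/-- Planes depend continuously on a basis. -/
theorem tendsto_starProjection_span_pair [FiniteDimensional ℝ E] {α : Type*} {l : Filter α}
    {a : E} {f : α → E} {b : E}
    (hab : b ∉ Submodule.span ℝ {a}) (hf : Tendsto f l (𝓝 b)) :
    Tendsto (fun t => (Submodule.span ℝ {a} ⊔ Submodule.span ℝ {f t}).starProjection) l
      (𝓝 (Submodule.span ℝ {a} ⊔ Submodule.span ℝ {b}).starProjection) := by
  simp only [starProjection_span_pair]
  refine tendsto_const_nhds.add (tendsto_lineProj ?_ ?_)
  · intro h
    apply hab
    obtain ⟨c, hc⟩ := lineProj_mem a b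
    rw [sub_eq_zero.mp h, hc]
    exact Submodule.smul_mem _ _ (Submodule.mem_span_singleton_self a)
  · exact hf.sub (((lineProj a).continuous.tendsto b).comp hf)

end Proj

/-! ### Transversality of tangent lines in terms of the Gram determinant -/

section Transverse

variable {n : ℕ}

/-- The plane of `⋀ⁿ ℝ²ⁿ` with basis `a`, `b`, given in coordinates. -/
def planeOf (a b : WedgeEuc n) : Submodule ℝ (Wedge n) :=
  (Submodule.span ℝ {a} ⊔ Submodule.span ℝ {b}).comap (wedgeCoord n).toLinearMap

theorem mem_planeOf {a b : WedgeEuc n} {z : Wedge n} :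
    z ∈ planeOf a b ↔ ∃ α β : ℝ, α • (wedgeCoord n).symm a + β • (wedgeCoord n).symm b = z := by
  rw [planeOf, Submodule.mem_comap, Submodule.mem_sup]
  simp only [Submodule.mem_span_singleton]
  constructor
  · rintro ⟨_, ⟨α, rfl⟩, _, ⟨β, rfl⟩, h⟩
    refine ⟨α, β, (wedgeCoord n).injective ?_⟩
    rw [map_add, map_smul, map_smul, LinearEquiv.apply_symm_apply, LinearEquiv.apply_symm_apply]
    exact h
  · rintro ⟨α, β, rfl⟩
    refine ⟨_, ⟨α, rfl⟩, _, ⟨β, rfl⟩, ?_⟩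
    simp

theorem map_planeOf (a b : WedgeEuc n) :
    (planeOf a b).map (wedgeCoord n).toLinearMap =
      Submodule.span ℝ {a} ⊔ Submodule.span ℝ {b} := by
  rw [planeOf, Submodule.map_comap_eq_of_surjective (wedgeCoord n).surjective]

theorem finrank_planeOf {a b : WedgeEuc n} (ha : a ≠ 0) (hab : b ∉ Submodule.span ℝ {a}) :
    Module.finrank ℝ (planeOf a b) = 2 := by
  have h1 : Module.finrank ℝ (planeOf a b) =
      Module.finrank ℝ ((planeOf a b).map (wedgeCoord n).toLinearMap) :=
    ((wedgeCoord n).finrank_map_eq (planeOf a b)).symm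
  rw [h1, map_planeOf, ← Submodule.span_union, Set.singleton_union]
  have hli : LinearIndependent ℝ ![a, b] := by
    rw [LinearIndependent.pair_iff' ha]
    intro c hc
    exact hab (hc ▸ Submodule.smul_mem _ _ (Submodule.mem_span_singleton_self a))
  have := finrank_span_eq_card hli
  rwa [Matrix.range_cons, Matrix.range_cons, Matrix.range_empty, Set.union_empty,
    Set.singleton_union, Fintype.card_fin] at this

/-- The Gram determinant of two planes for the form `ω'`. -/
def gram (a b c d : WedgeEuc n) : ℝ :=
  omegaE n c a * omegaE n d b - omegaE n c b * omegaE n d a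

theorem mem_Ann_planeOf {a b : WedgeEuc n} {z : Wedge n} :
    z ∈ Ann (planeOf a b) ↔
      omega' n z ((wedgeCoord n).symm a) = 0 ∧ omega' n z ((wedgeCoord n).symm b) = 0 := by
  constructor
  · intro h
    exact ⟨h _ (mem_planeOf.mpr ⟨1, 0, by simp⟩), h _ (mem_planeOf.mpr ⟨0, 1, by simp⟩)⟩
  · rintro ⟨h1, h2⟩ v hv
    obtain ⟨α, β, rfl⟩ := mem_planeOf.mp hv
    simp [h1, h2]

theorem isCompl_planeOf_iff {a b c d : WedgeEuc n} (hc : c ≠ 0) (hcd : d ∉ Submodule.span ℝ {c}) :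
    IsCompl (planeOf c d) (Ann (planeOf a b)) ↔ gram a b c d ≠ 0 := by
  set p := omegaE n c a with hp
  set q := omegaE n c b with hq
  set r := omegaE n d a with hr
  set s := omegaE n d b with hs
  have hG : gram a b c d = p * s - q * r := rfl
  have hindep : ∀ α β : ℝ, α • (wedgeCoord n).symm c + β • (wedgeCoord n).symm d = 0 →
      α = 0 ∧ β = 0 := by
    intro α β h
    have hli : LinearIndependent ℝ ![c, d] := by
      rw [LinearIndependent.pair_iff' hc]
      intro c' hc'
      exact hcd (hc' ▸ Submodule.smul_mem _ _ (Submodule.mem_span_singleton_self c))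
    refine LinearIndependent.pair_iff.mp hli α β ?_
    have := congrArg (wedgeCoord n) h
    simpa using this
  have hform : ∀ (α β : ℝ) (e : WedgeEuc n),
      omega' n (α • (wedgeCoord n).symm c + β • (wedgeCoord n).symm d) ((wedgeCoord n).symm e) =
        α * omegaE n c e + β * omegaE n d e := by
    intro α β e
    simp [omegaE_apply]
  constructor
  · intro h hG0
    rw [hG] at hG0
    have hmem : ∀ α β : ℝ, α * p + β * r = 0 → α * q + β * s = 0 → α = 0 ∧ β = 0 := by
      intro α β h1 h2
      apply hindep
      have := (Submodule.disjoint_def.mp h.disjoint)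
        (α • (wedgeCoord n).symm c + β • (wedgeCoord n).symm d) (mem_planeOf.mpr ⟨_, _, rfl⟩)
        (mem_Ann_planeOf.mpr ⟨by rw [hform]; exact h1, by rw [hform]; exact h2⟩)
      exact this
    have h1 := hmem s (-q) (by linarith) (by ring)
    have h2 := hmem r (-p) (by ring) (by linarith)
    have h3 := hmem 1 0 (by linarith [h2.2]) (by linarith [h1.2])
    exact one_ne_zero h3.1
  · intro hne
    rw [hG] at hne
    refine IsCompl.of_eq ?_ ?_
    · rw [Submodule.eq_bot_iff]
      rintro z ⟨hz1, hz2⟩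
      obtain ⟨α, β, rfl⟩ := mem_planeOf.mp hz1
      obtain ⟨h1, h2⟩ := mem_Ann_planeOf.mp hz2
      rw [hform] at h1 h2
      have hα : α = 0 := by
        have : (p * s - q * r) * α = 0 := by linear_combination s * h1 - r * h2
        exact (mul_eq_zero.mp this).resolve_left hne
      have hβ : β = 0 := by
        have : (p * s - q * r) * β = 0 := by linear_combination p * h2 - q * h1
        exact (mul_eq_zero.mp this).resolve_left hne
      simp [hα, hβ]
    · rw [Submodule.eq_top_iff']
      intro z
      set x := omega' n z ((wedgeCoord n).symm a) with hx
      set y := omega' n z ((wedgeCoord n).symm b) with hy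
      set α := (s * x - r * y) / (p * s - q * r) with hα
      set β := (p * y - q * x) / (p * s - q * r) with hβ
      have hα' : α * (p * s - q * r) = s * x - r * y := div_mul_cancel₀ _ hne
      have hβ' : β * (p * s - q * r) = p * y - q * x := div_mul_cancel₀ _ hne
      rw [Submodule.mem_sup]
      refine ⟨α • (wedgeCoord n).symm c + β • (wedgeCoord n).symm d, mem_planeOf.mpr ⟨_, _, rfl⟩,
        z - (α • (wedgeCoord n).symm c + β • (wedgeCoord n).symm d),
        mem_Ann_planeOf.mpr ⟨?_, ?_⟩, by abel⟩
      · rw [map_sub, LinearMap.sub_apply, hform, ← hx, ← hp, ← hr]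
        refine mul_left_cancel₀ hne ?_
        linear_combination -p * hα' - r * hβ'
      · rw [map_sub, LinearMap.sub_apply, hform, ← hy, ← hq, ← hs]
        refine mul_left_cancel₀ hne ?_
        linear_combination -q * hα' - s * hβ'

end Transverse

/-! ### Lipschitz curves and bilinear forms -/

section CrossRatio

variable {E : Type*} [NormedAddCommGroup E] [NormedSpace ℝ E]

theorem ae_differentiableAt_of_lipschitzOnWith_Icc [FiniteDimensional ℝ E] {w : ℝ → E} {J : Set ℝ}
    (hJ : IsOpen J) (hLip : ∀ a ∈ J, ∀ b ∈ J, ∃ K, LipschitzOnWith K w (Set.Icc a b)) :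
    ∀ᵐ s, s ∈ J → DifferentiableAt ℝ w s := by
  have hbv : LocallyBoundedVariationOn w J := by
    intro a b ha hb
    obtain ⟨K, hK⟩ := hLip a ha b hb
    by_cases hab : a ≤ b
    · have := hK.locallyBoundedVariationOn a b (Set.left_mem_Icc.mpr hab)
        (Set.right_mem_Icc.mpr hab)
      rw [Set.inter_self] at this
      exact this.mono Set.inter_subset_right
    · rw [Set.Icc_eq_empty hab, Set.inter_empty]
      simp [BoundedVariationOn]
  filter_upwards [hbv.ae_differentiableWithinAt_of_mem] with s hs hsJ
  exact (hs hsJ).differentiableAt (hJ.mem_nhds hsJ)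

theorem exists_lipschitzOnWith_comp {w : ℝ → E} {a b : ℝ} {K : NNReal}
    (hw : LipschitzOnWith K w (Set.Icc a b)) {f : E → ℝ}
    (hf : ∀ t ∈ Set.Icc a b, ContDiffAt ℝ 1 f (w t)) :
    ∃ K', LipschitzOnWith K' (fun t => f (w t)) (Set.Icc a b) := by
  apply LocallyLipschitzOn.exists_lipschitzOnWith_of_compact isCompact_Icc
  intro t ht
  obtain ⟨K', U, hU, hK'⟩ := (hf t ht).exists_lipschitzOnWith
  refine ⟨K' * K, w ⁻¹' U ∩ Set.Icc a b, inter_mem (hw.continuousOn t ht hU) self_mem_nhdsWithin, ?_⟩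
  exact hK'.comp (hw.mono Set.inter_subset_right) fun x hx => hx.1

/-- A locally Lipschitz curve `w` and a bilinear form `B` such that `B (w t) (w s)` vanishes exactly
for `s = t`: the tangent lines of `w` at almost all pairs of points cannot be all degenerate
for `B`. -/
theorem not_ae_gram_eq_zero [FiniteDimensional ℝ E] {w : ℝ → E} {J : Set ℝ} (hJ : IsOpen J)
    (hJne : J.Nonempty) (hJc : J.OrdConnected)
    (hLip : ∀ a ∈ J, ∀ b ∈ J, ∃ K, LipschitzOnWith K w (Set.Icc a b)) (B : E →ₗ[ℝ] E →ₗ[ℝ] ℝ)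
    (hdiag : ∀ s ∈ J, B (w s) (w s) = 0)
    (hoff : ∀ s ∈ J, ∀ t ∈ J, s ≠ t → B (w t) (w s) ≠ 0) :
    ¬ ∀ᵐ s, s ∈ J → ∀ᵐ t, t ∈ J → s ≠ t → DifferentiableAt ℝ w s → DifferentiableAt ℝ w t →
      B (w t) (w s) * B (deriv w t) (deriv w s) - B (w t) (deriv w s) * B (deriv w t) (w s) = 0 := by
  intro hae
  have hdiff := ae_differentiableAt_of_lipschitzOnWith_Icc hJ hLip
  have hL : ∀ e : E, ∃ L : E →L[ℝ] ℝ, ∀ x, L x = B x e := fun e =>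
    ⟨(B.flip e).toContinuousLinearMap, fun x => rfl⟩
  have hR : ∀ e : E, ∃ L : E →L[ℝ] ℝ, ∀ x, L x = B e x := fun e =>
    ⟨(B e).toContinuousLinearMap, fun x => rfl⟩
  have hcross : ∀ s₁ ∈ J, ∀ s₂ ∈ J, ∀ t₁ ∈ J, ∀ t₂ ∈ J, s₁ < s₂ → s₂ < t₁ → t₁ < t₂ →
      B (w t₁) (w s₁) * B (w t₂) (w s₂) = B (w t₁) (w s₂) * B (w t₂) (w s₁) := by
    intro s₁ hs₁ s₂ hs₂ t₁ ht₁ t₂ ht₂ h12 h23 h34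
    obtain ⟨K₁, hK₁⟩ := hLip s₁ hs₁ s₂ hs₂
    obtain ⟨K₂, hK₂⟩ := hLip t₁ ht₁ t₂ ht₂
    have hsub₁ : Set.Icc s₁ s₂ ⊆ J := hJc.out hs₁ hs₂
    have hsub₂ : Set.Icc t₁ t₂ ⊆ J := hJc.out ht₁ ht₂
    -- for almost every `s`, the logarithmic derivative in `s` does not depend on `t`
    have hconst : ∀ᵐ s, s ∈ Set.uIcc s₁ s₂ → DifferentiableAt ℝ w s ∧
        B (w t₁) (deriv w s) / B (w t₁) (w s) = B (w t₂) (deriv w s) / B (w t₂) (w s) := by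
      filter_upwards [hae, hdiff] with s hs hds hmem
      rw [Set.uIcc_of_le h12.le] at hmem
      have hsJ := hsub₁ hmem
      have hds := hds hsJ
      refine ⟨hds, ?_⟩
      obtain ⟨L, hLx⟩ := hL (deriv w s)
      obtain ⟨M, hMx⟩ := hL (w s)
      have hM0 : ∀ t ∈ Set.Icc t₁ t₂, M (w t) ≠ 0 := by
        intro t ht
        rw [hMx]
        exact hoff s hsJ t (hsub₂ ht) (by have := hmem.2; have := ht.1; intro h; linarith)
      obtain ⟨K, hK⟩ := exists_lipschitzOnWith_comp hK₂ (f := fun e => L e / M e)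
        (fun t ht => L.contDiff.contDiffAt.div M.contDiff.contDiffAt (hM0 t ht))
      have hac : AbsolutelyContinuousOnInterval (fun t => L (w t) / M (w t)) t₁ t₂ :=
        LipschitzOnWith.absolutelyContinuousOnInterval (by rwa [Set.uIcc_of_le h34.le])
      obtain ⟨C, hC⟩ := hac.const_of_ae_hasDerivAt_zero (by
        filter_upwards [hs hsJ, hdiff] with t hst hdt hmemt
        rw [Set.uIcc_of_le h34.le] at hmemt
        have htJ := hsub₂ hmemt
        have hdt := hdt htJ
        have hz := hst htJ (by have := hmem.2; have := hmemt.1; intro h; linarith) hds hdt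
        have h1 : HasDerivAt (fun t => L (w t)) (L (deriv w t)) t :=
          L.hasFDerivAt.comp_hasDerivAt t hdt.hasDerivAt
        have h2 : HasDerivAt (fun t => M (w t)) (M (deriv w t)) t :=
          M.hasFDerivAt.comp_hasDerivAt t hdt.hasDerivAt
        have h3 := h1.div h2 (hM0 t hmemt)
        have h4 : L (deriv w t) * M (w t) - L (w t) * M (deriv w t) = 0 := by
          rw [hLx, hLx, hMx, hMx]
          linarith
        rw [h4, zero_div] at h3
        exact h3)
      have e1 := hC t₁ (by simp)
      have e2 := hC t₂ (by simp)
      rw [← e2] at e1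
      simpa only [hLx, hMx] using e1
    obtain ⟨L, hLx⟩ := hR (w t₁)
    obtain ⟨M, hMx⟩ := hR (w t₂)
    have hL0 : ∀ s ∈ Set.Icc s₁ s₂, L (w s) ≠ 0 := by
      intro s hs
      rw [hLx]
      exact hoff s (hsub₁ hs) t₁ ht₁ (by have := hs.2; intro h; linarith)
    have hM0 : ∀ s ∈ Set.Icc s₁ s₂, M (w s) ≠ 0 := by
      intro s hs
      rw [hMx]
      exact hoff s (hsub₁ hs) t₂ ht₂ (by have := hs.2; intro h; linarith)
    obtain ⟨K, hK⟩ := exists_lipschitzOnWith_comp hK₁ (f := fun e => L e / M e)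
      (fun s hs => L.contDiff.contDiffAt.div M.contDiff.contDiffAt (hM0 s hs))
    have hac : AbsolutelyContinuousOnInterval (fun s => L (w s) / M (w s)) s₁ s₂ :=
      LipschitzOnWith.absolutelyContinuousOnInterval (by rwa [Set.uIcc_of_le h12.le])
    obtain ⟨C, hC⟩ := hac.const_of_ae_hasDerivAt_zero (by
      filter_upwards [hconst] with s hs hmem
      obtain ⟨hds, hq⟩ := hs hmem
      rw [Set.uIcc_of_le h12.le] at hmem
      have h1 : HasDerivAt (fun s => L (w s)) (L (deriv w s)) s :=
        L.hasFDerivAt.comp_hasDerivAt s hds.hasDerivAt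
      have h2 : HasDerivAt (fun s => M (w s)) (M (deriv w s)) s :=
        M.hasFDerivAt.comp_hasDerivAt s hds.hasDerivAt
      have h3 := h1.div h2 (hM0 s hmem)
      rw [← hLx, ← hLx, ← hMx, ← hMx, div_eq_div_iff (hL0 s hmem) (hM0 s hmem)] at hq
      rw [show L (deriv w s) * M (w s) - L (w s) * M (deriv w s) = 0 by linarith, zero_div] at h3
      exact h3)
    have e1 := hC s₁ (by simp)
    have e2 := hC s₂ (by simp)
    rw [← e2, div_eq_div_iff (hM0 s₁ (Set.left_mem_Icc.mpr h12.le))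
      (hM0 s₂ (Set.right_mem_Icc.mpr h12.le))] at e1
    simpa only [hLx, hMx] using e1
  obtain ⟨t₁, ht₁⟩ := hJne
  obtain ⟨ε, hε, hball⟩ := Metric.isOpen_iff.mp hJ t₁ ht₁
  have hin : ∀ x, |x - t₁| < ε → x ∈ J := fun x hx => hball (by
    rwa [Metric.mem_ball, Real.dist_eq])
  have hs₁ : t₁ - ε / 2 ∈ J := hin _ (by rw [abs_lt]; constructor <;> linarith)
  have ht₂ : t₁ + ε / 2 ∈ J := hin _ (by rw [abs_lt]; constructor <;> linarith)
  obtain ⟨K, hK⟩ := hLip _ hs₁ _ ht₂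
  have hwc : Tendsto w (𝓝[<] t₁) (𝓝 (w t₁)) :=
    (hK.continuousOn.continuousAt (Icc_mem_nhds (by linarith) (by linarith))).tendsto.mono_left
      nhdsWithin_le_nhds
  obtain ⟨L, hLx⟩ := hR (w t₁)
  obtain ⟨M, hMx⟩ := hR (w (t₁ + ε / 2))
  have hlim1 : Tendsto (fun s => B (w t₁) (w (t₁ - ε / 2)) * M (w s)) (𝓝[<] t₁)
      (𝓝 (B (w t₁) (w (t₁ - ε / 2)) * M (w t₁))) :=
    ((M.continuous.tendsto _).comp hwc).const_mul _
  have hlim2 : Tendsto (fun s => L (w s) * B (w (t₁ + ε / 2)) (w (t₁ - ε / 2))) (𝓝[<] t₁)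
      (𝓝 (L (w t₁) * B (w (t₁ + ε / 2)) (w (t₁ - ε / 2)))) :=
    ((L.continuous.tendsto _).comp hwc).mul_const _
  have heq : (fun s => B (w t₁) (w (t₁ - ε / 2)) * M (w s)) =ᶠ[𝓝[<] t₁]
      (fun s => L (w s) * B (w (t₁ + ε / 2)) (w (t₁ - ε / 2))) := by
    filter_upwards [Ioo_mem_nhdsLT (show t₁ - ε / 2 < t₁ by linarith)] with s hs
    rw [hLx, hMx]
    exact hcross _ hs₁ s (hin s (by rw [abs_lt]; constructor <;> linarith [hs.1, hs.2])) _ ht₁ _ ht₂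
      hs.1 hs.2 (by linarith)
  have hfin := tendsto_nhds_unique (hlim1.congr' heq) hlim2
  rw [hLx, hMx, hdiag t₁ ht₁, zero_mul] at hfin
  rcases mul_eq_zero.mp hfin with h | h
  · exact hoff _ hs₁ _ ht₁ (by linarith) h
  · exact hoff _ ht₁ _ ht₂ (by linarith) h

end CrossRatio

/-! ### Hausdorff measure of Lipschitz images -/

theorem hausdorffMeasure_image_le_of_dist_le {S X Y : Type*} [MetricSpace X] [MeasurableSpace X]
    [BorelSpace X] [MetricSpace Y] [MeasurableSpace Y] [BorelSpace Y] {f : S → X} {g : S → Y}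
    {K : Set S} {C : ℝ} (hC : 0 ≤ C)
    (h : ∀ x ∈ K, ∀ y ∈ K, dist (f x) (f y) ≤ C * dist (g x) (g y)) :
    Measure.hausdorffMeasure 1 (f '' K) ≤
      ENNReal.ofReal C * Measure.hausdorffMeasure 1 (g '' K) := by
  classical
  rcases isEmpty_or_nonempty S with hS | hS
  · rw [Set.eq_empty_of_isEmpty K]; simp
  let k : Y → X := fun y => f (Function.invFunOn g K y)
  have hk : ∀ x ∈ K, k (g x) = f x := by
    intro x hx
    have h1 : Function.invFunOn g K (g x) ∈ K := Function.invFunOn_mem ⟨x, hx, rfl⟩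
    have h2 : g (Function.invFunOn g K (g x)) = g x := Function.invFunOn_eq ⟨x, hx, rfl⟩
    have h3 := h _ h1 x hx
    rw [h2, dist_self, mul_zero] at h3
    exact dist_le_zero.mp h3
  have himg : f '' K = k '' (g '' K) := by
    rw [Set.image_image]
    exact Set.image_congr fun x hx => (hk x hx).symm
  have hlip : LipschitzOnWith (Real.toNNReal C) k (g '' K) := by
    refine LipschitzOnWith.of_dist_le_mul ?_
    rintro _ ⟨x, hx, rfl⟩ _ ⟨y, hy, rfl⟩
    rw [hk x hx, hk y hy, Real.coe_toNNReal C hC]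
    exact h x hx y hy
  rw [himg]
  have := hlip.hausdorffMeasure_image_le (d := 1) zero_le_one
  simpa [ENNReal.ofReal] using this

section Curve

variable {n : ℕ}

/-! ### The curve in an affine chart of the projective space -/

/-- `v` lifts the curve `ξ₁` away from `x₀` to an affine hyperplane of `⋀ⁿ ℝ²ⁿ`, and is a locally
Lipschitz function of the parameter `τ`, which is itself a linear function of `v`. -/
structure IsChartCurve (ξ₁ : Bdry → ℙ ℝ (Wedge n)) (x₀ : Bdry) (v : Bdry → WedgeEuc n)
    (τ : Bdry → ℝ) : Prop where
  span_eq : ∀ x, x ≠ x₀ →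
    (ξ₁ x).submodule.map (wedgeCoord n).toLinearMap = Submodule.span ℝ {v x}
  continuousAt : ∀ x, x ≠ x₀ → ContinuousAt v x
  exists_forms : ∃ μ ν : WedgeEuc n →L[ℝ] ℝ, ∀ x, μ (v x) = 1 ∧ ν (v x) = τ x
  param_ne : ∀ x y, x ≠ x₀ → y ≠ x₀ → x ≠ y → τ x ≠ τ y
  omegaE_ne : ∀ x y, x ≠ x₀ → y ≠ x₀ → x ≠ y → omegaE n (v x) (v y) ≠ 0
  omegaE_self : ∀ x, omegaE n (v x) (v x) = 0
  lipschitz : ∀ K : Set Bdry, IsCompact K → x₀ ∉ K → ∃ C : ℝ, 0 ≤ C ∧ (∀ x ∈ K, ‖v x‖ ≤ C) ∧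
    ∀ x ∈ K, ∀ y ∈ K, ‖v x - v y‖ ≤ C * |τ x - τ y|

theorem exists_isChartCurve (hn : 0 < n) {ξ : Bdry → Flag n} (hc : Continuous ξ)
    (hpos : ∀ x : Fin 3 → Bdry, CyclicallyOrdered x → IsPositiveTuple (fun i => ξ (x i)))
    (x₀ : Bdry) : ∃ v τ, IsChartCurve (plucker ∘ ξ) x₀ v τ := by
  obtain ⟨g, S, hS, hdef⟩ := exists_chart hc hpos x₀
  obtain ⟨μ, hμ⟩ := exists_form_eq_one g
  obtain ⟨ν, hν⟩ := exists_form_eq_trace g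
  let s : Bdry → (Fin n → Fin n → ℝ) := fun x i j => S x i j
  have hsc : ∀ x, x ≠ x₀ → ContinuousAt s x := by
    intro x hx
    refine continuousAt_pi.mpr fun i => continuousAt_pi.mpr fun j => ?_
    exact ((continuous_apply_apply i j).continuousAt (x := S x)).comp (hS x hx).1
  refine ⟨fun x => pluckVec g (s x), fun x => ∑ i, s x i i, ?_, ?_,
    ⟨μ.toContinuousLinearMap, ν.toContinuousLinearMap, fun x => ⟨hμ _, hν _⟩⟩, ?_, ?_, ?_, ?_⟩
  · intro x hx
    obtain ⟨hSx, hx'⟩ := (hS x hx).2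
    rw [Function.comp_apply, hx']
    exact plucker_submodule_map g (S x) hSx
  · intro x hx
    exact (contDiff_pluckVec g).continuous.continuousAt.comp (hsc x hx)
  · intro x y hx hy hxy h
    have := (hdef x y hx hy hxy).trace_ne_zero hn
    rw [Matrix.trace_sub, sub_ne_zero] at this
    exact this h
  · intro x y hx hy hxy
    rw [omegaE_pluckVec]
    have h1 := (Matrix.isUnit_iff_isUnit_det _).mp (hdef x y hx hy hxy).isUnit
    exact h1.ne_zero
  · intro x
    have : Nonempty (Fin n) := ⟨⟨0, hn⟩⟩
    rw [omegaE_pluckVec, sub_self, Matrix.det_zero]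
  · intro K hK hx₀
    have hsK : ContinuousOn s K := fun x hx =>
      (hsc x (fun h => hx₀ (h ▸ hx))).continuousWithinAt
    obtain ⟨R, hR⟩ := (hK.image_of_continuousOn hsK).isBounded.subset_closedBall 0
    obtain ⟨C₁, hC₁⟩ := (contDiff_pluckVec g).contDiffOn.exists_lipschitzOnWith one_ne_zero
      (convex_closedBall 0 R) (isCompact_closedBall (0 : Fin n → Fin n → ℝ) R)
    obtain ⟨C₂, hC₂⟩ := ((isCompact_closedBall (0 : Fin n → Fin n → ℝ) R).image
      (contDiff_pluckVec g).continuous).isBounded.exists_norm_le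
    have hmem : ∀ x ∈ K, s x ∈ Metric.closedBall 0 R := fun x hx => hR ⟨x, hx, rfl⟩
    refine ⟨max C₁ (max C₂ 0), le_max_of_le_right (le_max_right _ _), ?_, ?_⟩
    · intro x hx
      exact (hC₂ _ ⟨_, hmem x hx, rfl⟩).trans
        (le_max_of_le_right (le_max_left _ _))
    · intro x hx y hy
      have hdist : ‖s x - s y‖ ≤ |∑ i, s x i i - ∑ i, s y i i| := by
        by_cases hxy : x = y
        · simp [hxy]
        have hd := hdef x y (fun h => hx₀ (h ▸ hx)) (fun h => hx₀ (h ▸ hy)) hxy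
        refine (pi_norm_le_iff_of_nonneg (abs_nonneg _)).mpr fun i =>
          (pi_norm_le_iff_of_nonneg (abs_nonneg _)).mpr fun j => ?_
        have := hd.abs_apply_le_abs_trace i j
        rw [Matrix.trace_sub] at this
        exact this
      have h1 := hC₁.dist_le_mul _ (hmem x hx) _ (hmem y hy)
      rw [dist_eq_norm, dist_eq_norm] at h1
      calc _ ≤ _ := h1
        _ ≤ max (C₁ : ℝ) (max C₂ 0) * |∑ i, s x i i - ∑ i, s y i i| := by
          gcongr
          exact le_max_left _ _

namespace IsChartCurve

variable {ξ₁ : Bdry → ℙ ℝ (Wedge n)} {x₀ : Bdry} {v : Bdry → WedgeEuc n} {τ : Bdry → ℝ}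

theorem subspaceProj_eq (h : IsChartCurve ξ₁ x₀ v τ) {x : Bdry} (hx : x ≠ x₀) :
    subspaceProj (ξ₁ x).submodule = lineProj (v x) := by
  simp only [subspaceProj, lineProj, h.span_eq x hx]

theorem dist_eq (h : IsChartCurve ξ₁ x₀ v τ) {x y : Bdry} (hx : x ≠ x₀) (hy : y ≠ x₀) :
    dist (ξ₁ x) (ξ₁ y) = ‖lineProj (v x) - lineProj (v y)‖ := by
  rw [← h.subspaceProj_eq hx, ← h.subspaceProj_eq hy, ← dist_eq_norm]
  rfl

theorem lift_ne_zero (h : IsChartCurve ξ₁ x₀ v τ) (x : Bdry) : v x ≠ 0 := by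
  obtain ⟨μ, ν, hμ⟩ := h.exists_forms
  intro h0
  have := (hμ x).1
  rw [h0, map_zero] at this
  exact zero_ne_one this

theorem continuousAt_param (h : IsChartCurve ξ₁ x₀ v τ) {x : Bdry} (hx : x ≠ x₀) :
    ContinuousAt τ x := by
  obtain ⟨μ, ν, hμ⟩ := h.exists_forms
  have : τ = fun x => ν (v x) := funext fun x => (hμ x).2.symm
  rw [this]
  exact ν.continuous.continuousAt.comp (h.continuousAt x hx)

theorem continuousAt_curve (h : IsChartCurve ξ₁ x₀ v τ) {x : Bdry} (hx : x ≠ x₀) :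
    ContinuousAt ξ₁ x := by
  rw [ContinuousAt, tendsto_iff_dist_tendsto_zero]
  have h1 := tendsto_lineProj (h.lift_ne_zero x) (h.continuousAt x hx)
  rw [tendsto_iff_norm_sub_tendsto_zero] at h1
  refine h1.congr' ?_
  filter_upwards [isOpen_ne.mem_nhds hx] with y hy
  exact (h.dist_eq hy hx).symm

/-- On compact sets, the distance along the curve is comparable with the parameter. -/
theorem exists_dist_comparison (h : IsChartCurve ξ₁ x₀ v τ) {K : Set Bdry} (hK : IsCompact K)
    (hx₀ : x₀ ∉ K) : ∃ C : ℝ, 0 ≤ C ∧ ∀ x ∈ K, ∀ y ∈ K,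
      dist (ξ₁ x) (ξ₁ y) ≤ C * |τ x - τ y| ∧ |τ x - τ y| ≤ C * dist (ξ₁ x) (ξ₁ y) := by
  obtain ⟨μ, ν, hμ⟩ := h.exists_forms
  obtain ⟨C, hC, hCv, hCL⟩ := h.lipschitz K hK hx₀
  have hne : ∀ x ∈ K, x ≠ x₀ := fun x hx h => hx₀ (h ▸ hx)
  have hμ0 : 0 < ‖μ‖ := by
    rw [norm_pos_iff]
    rintro rfl
    have := (hμ x₀).1
    simp at this
  have hlow : ∀ x, ‖μ‖⁻¹ ≤ ‖v x‖ := by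
    intro x
    have := μ.le_opNorm (v x)
    rw [(hμ x).1, norm_one] at this
    rwa [inv_le_iff_one_le_mul₀' hμ0]
  set A := 2 / ‖μ‖⁻¹ * C with hA
  set B := ‖ν‖ * (C + ‖μ‖ * C * C) with hB
  have hA0 : 0 ≤ A := by positivity
  have hB0 : 0 ≤ B := by positivity
  refine ⟨A + B, by positivity, fun x hx y hy => ⟨?_, ?_⟩⟩
  · rw [h.dist_eq (hne x hx) (hne y hy)]
    calc _ ≤ 2 / ‖μ‖⁻¹ * ‖v x - v y‖ := norm_lineProj_sub_le (by positivity) (hlow x) (hlow y)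
      _ ≤ 2 / ‖μ‖⁻¹ * (C * |τ x - τ y|) := by gcongr; exact hCL x hx y hy
      _ = A * |τ x - τ y| := by ring
      _ ≤ (A + B) * |τ x - τ y| := by gcongr; linarith
  · have h1 := norm_sub_le_lineProj μ (hμ x).1 (hμ y).1 (hCv x hx) (hCv y hy)
    rw [← h.dist_eq (hne x hx) (hne y hy)] at h1
    have h2 : |τ x - τ y| ≤ ‖ν‖ * ‖v x - v y‖ := by
      rw [← (hμ x).2, ← (hμ y).2, ← map_sub, ← Real.norm_eq_abs]
      exact ν.le_opNorm _
    calc _ ≤ _ := h2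
      _ ≤ ‖ν‖ * ((C + ‖μ‖ * C * C) * dist (ξ₁ x) (ξ₁ y)) := by gcongr
      _ = B * dist (ξ₁ x) (ξ₁ y) := by ring
      _ ≤ (A + B) * dist (ξ₁ x) (ξ₁ y) := by gcongr; linarith

theorem curve_ne (h : IsChartCurve ξ₁ x₀ v τ) {x y : Bdry} (hx : x ≠ x₀) (hy : y ≠ x₀)
    (hxy : x ≠ y) : ξ₁ x ≠ ξ₁ y := by
  intro he
  obtain ⟨C, -, hC⟩ := h.exists_dist_comparison (K := {x, y}) (Set.toFinite _).isCompact
    (by simp [hx.symm, hy.symm])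
  have := (hC x (by simp) y (by simp)).2
  rw [he, dist_self, mul_zero] at this
  exact h.param_ne x y hx hy hxy (sub_eq_zero.mp (abs_nonpos_iff.mp this))

theorem neg (h : IsChartCurve ξ₁ x₀ v τ) : IsChartCurve ξ₁ x₀ v (-τ) where
  span_eq := h.span_eq
  continuousAt := h.continuousAt
  exists_forms := by
    obtain ⟨μ, ν, hμ⟩ := h.exists_forms
    exact ⟨μ, -ν, fun x => ⟨(hμ x).1, by simp [(hμ x).2]⟩⟩
  param_ne x y hx hy hxy := by simpa using h.param_ne x y hx hy hxy
  omegaE_ne := h.omegaE_ne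
  omegaE_self := h.omegaE_self
  lipschitz K hK hx₀ := by
    obtain ⟨C, hC, hCv, hCL⟩ := h.lipschitz K hK hx₀
    refine ⟨C, hC, hCv, fun x hx y hy => ?_⟩
    have := hCL x hx y hy
    rwa [abs_sub_comm, show τ y - τ x = (-τ) x - (-τ) y by simp; ring] at this

end IsChartCurve

/-- The chart at `∞`, with increasing parameter. -/
theorem exists_isChartCurve_strictMono (hn : 0 < n) {ξ : Bdry → Flag n} (hc : Continuous ξ)
    (hpos : ∀ x : Fin 3 → Bdry, CyclicallyOrdered x → IsPositiveTuple (fun i => ξ (x i))) :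
    ∃ v τ, IsChartCurve (plucker ∘ ξ) OnePoint.infty v τ ∧ StrictMono fun t : ℝ => τ t := by
  obtain ⟨v, τ, h⟩ := exists_isChartCurve hn hc hpos OnePoint.infty
  have hcont : Continuous fun t : ℝ => τ t := by
    rw [continuous_iff_continuousAt]
    intro t
    exact (h.continuousAt_param (OnePoint.coe_ne_infty t)).comp
      OnePoint.continuous_coe.continuousAt
  have hinj : Function.Injective fun t : ℝ => τ t := by
    intro s t hst
    by_contra hne
    exact h.param_ne s t (OnePoint.coe_ne_infty s) (OnePoint.coe_ne_infty t)
      (fun h => hne (OnePoint.coe_injective h)) hst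
  rcases hcont.strictMono_of_inj hinj with hm | ha
  · exact ⟨v, τ, h, hm⟩
  · exact ⟨v, -τ, h.neg, ha.neg⟩

theorem exists_ne_ne (x y : Bdry) : ∃ z : Bdry, x ≠ z ∧ y ≠ z := by
  classical
  obtain ⟨z, hz⟩ := Set.Infinite.exists_notMem_finset
    (Set.infinite_range_of_injective (OnePoint.coe_injective (X := ℝ))) ({x, y} : Finset Bdry)
  simp only [Finset.mem_insert, Finset.mem_singleton, not_or] at hz
  exact ⟨z, fun h => hz.2.1 h.symm, fun h => hz.2.2 h.symm⟩

theorem plucker_comp_continuous (hn : 0 < n) {ξ : Bdry → Flag n} (hc : Continuous ξ)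
    (hpos : ∀ x : Fin 3 → Bdry, CyclicallyOrdered x → IsPositiveTuple (fun i => ξ (x i))) :
    Continuous (plucker ∘ ξ) := by
  rw [continuous_iff_continuousAt]
  intro x
  obtain ⟨z, hz, -⟩ := exists_ne_ne x x
  obtain ⟨v, τ, h⟩ := exists_isChartCurve hn hc hpos z
  exact h.continuousAt_curve hz

theorem plucker_comp_injective (hn : 0 < n) {ξ : Bdry → Flag n} (hc : Continuous ξ)
    (hpos : ∀ x : Fin 3 → Bdry, CyclicallyOrdered x → IsPositiveTuple (fun i => ξ (x i))) :
    Function.Injective (plucker ∘ ξ) := by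
  intro x y hxy
  by_contra hne
  obtain ⟨z, hx, hy⟩ := exists_ne_ne x y
  obtain ⟨v, τ, h⟩ := exists_isChartCurve hn hc hpos z
  exact h.curve_ne hx hy hne hxy

theorem plucker_comp_isEmbedding (hn : 0 < n) {ξ : Bdry → Flag n} (hc : Continuous ξ)
    (hpos : ∀ x : Fin 3 → Bdry, CyclicallyOrdered x → IsPositiveTuple (fun i => ξ (x i))) :
    IsEmbedding (plucker ∘ ξ) :=
  ((plucker_comp_continuous hn hc hpos).isClosedEmbedding
    (plucker_comp_injective hn hc hpos)).isEmbedding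

end Curve

section Param

variable {n : ℕ} {ξ₁ : Bdry → ℙ ℝ (Wedge n)} {v : Bdry → WedgeEuc n} {τ : Bdry → ℝ}

/-! ### The curve as a function of its parameter -/

/-- The lift of the curve as a function of the parameter. -/
def paramLift (v : Bdry → WedgeEuc n) (τ : Bdry → ℝ) (s : ℝ) : WedgeEuc n :=
  v ((Function.invFun (fun t : ℝ => τ t) s : ℝ) : Bdry)

theorem paramLift_param (hm : StrictMono fun t : ℝ => τ t) (t : ℝ) :
    paramLift v τ (τ t) = v t := by
  rw [paramLift]
  congr 2
  exact Function.leftInverse_invFun hm.injective t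

/-- The range of the parameter. -/
def paramRange (τ : Bdry → ℝ) : Set ℝ := Set.range fun t : ℝ => τ t

namespace IsChartCurve

theorem continuous_param (h : IsChartCurve ξ₁ OnePoint.infty v τ) :
    Continuous fun t : ℝ => τ t := by
  rw [continuous_iff_continuousAt]
  intro t
  exact (h.continuousAt_param (OnePoint.coe_ne_infty t)).comp
    OnePoint.continuous_coe.continuousAt

theorem continuous_lift (h : IsChartCurve ξ₁ OnePoint.infty v τ) :
    Continuous fun t : ℝ => v t := by
  rw [continuous_iff_continuousAt]
  intro t
  exact (h.continuousAt _ (OnePoint.coe_ne_infty t)).comp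
    OnePoint.continuous_coe.continuousAt

theorem ordConnected_paramRange (h : IsChartCurve ξ₁ OnePoint.infty v τ) :
    (paramRange τ).OrdConnected :=
  (isPreconnected_range h.continuous_param).ordConnected

theorem isOpen_paramRange (h : IsChartCurve ξ₁ OnePoint.infty v τ)
    (hm : StrictMono fun t : ℝ => τ t) : IsOpen (paramRange τ) := by
  rw [isOpen_iff_mem_nhds]
  rintro _ ⟨t, rfl⟩
  have h1 : τ ((t - 1 : ℝ) : Bdry) < τ (t : Bdry) := hm (by linarith)
  have h2 : τ (t : Bdry) < τ ((t + 1 : ℝ) : Bdry) := hm (by linarith)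
  exact mem_of_superset (Icc_mem_nhds h1 h2)
    (h.ordConnected_paramRange.out ⟨t - 1, rfl⟩ ⟨t + 1, rfl⟩)

theorem exists_lipschitzOnWith_paramLift (h : IsChartCurve ξ₁ OnePoint.infty v τ)
    (hm : StrictMono fun t : ℝ => τ t) (a : ℝ) (ha : a ∈ paramRange τ) (b : ℝ)
    (hb : b ∈ paramRange τ) : ∃ K, LipschitzOnWith K (paramLift v τ) (Set.Icc a b) := by
  obtain ⟨a, rfl⟩ := ha
  obtain ⟨b, rfl⟩ := hb
  obtain ⟨C, hC, -, hL⟩ := h.lipschitz ((fun t : ℝ => (t : Bdry)) '' Set.Icc a b)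
    (isCompact_Icc.image OnePoint.continuous_coe) (by simp)
  refine ⟨Real.toNNReal C, LipschitzOnWith.of_dist_le_mul ?_⟩
  intro x hx y hy
  obtain ⟨s, rfl⟩ := h.ordConnected_paramRange.out ⟨a, rfl⟩ ⟨b, rfl⟩ hx
  obtain ⟨t, rfl⟩ := h.ordConnected_paramRange.out ⟨a, rfl⟩ ⟨b, rfl⟩ hy
  simp only [paramLift_param hm]
  rw [Real.coe_toNNReal C hC, dist_eq_norm, Real.dist_eq]
  exact hL _ ⟨s, ⟨hm.le_iff_le.mp hx.1, hm.le_iff_le.mp hx.2⟩, rfl⟩ _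
    ⟨t, ⟨hm.le_iff_le.mp hy.1, hm.le_iff_le.mp hy.2⟩, rfl⟩

theorem deriv_notMem_span (h : IsChartCurve ξ₁ OnePoint.infty v τ)
    (hm : StrictMono fun t : ℝ => τ t) {t : ℝ}
    (hd : DifferentiableAt ℝ (paramLift v τ) (τ t)) :
    deriv (paramLift v τ) (τ t) ∉ Submodule.span ℝ {v t} := by
  obtain ⟨μ, ν, hμ⟩ := h.exists_forms
  have h1 : μ (deriv (paramLift v τ) (τ t)) = 0 := by
    have e1 := μ.hasFDerivAt.comp_hasDerivAt _ hd.hasDerivAt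
    have e2 : (μ ∘ paramLift v τ) = fun _ => (1 : ℝ) := funext fun s => (hμ _).1
    rw [e2] at e1
    exact e1.unique (hasDerivAt_const _ _)
  have h2 : ν (deriv (paramLift v τ) (τ t)) = 1 := by
    have e1 := ν.hasFDerivAt.comp_hasDerivAt _ hd.hasDerivAt
    have e2 : (ν ∘ paramLift v τ) =ᶠ[𝓝 (τ t)] id := by
      filter_upwards [(h.isOpen_paramRange hm).mem_nhds ⟨t, rfl⟩] with s hs
      obtain ⟨r, rfl⟩ := hs
      simp only [Function.comp_apply, paramLift_param hm, (hμ _).2, id]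
    exact e1.unique ((hasDerivAt_id _).congr_of_eventuallyEq e2)
  intro hmem
  obtain ⟨c, hc⟩ := Submodule.mem_span_singleton.mp hmem
  rw [← hc, map_smul, (hμ _).1, smul_eq_mul, mul_one] at h1
  rw [← hc, h1, zero_smul, map_zero] at h2
  exact zero_ne_one h2

/-- At a point where the lift is differentiable, the tangent line is spanned by the lift and its
derivative. -/
theorem isTangentLine_iff (h : IsChartCurve ξ₁ OnePoint.infty v τ)
    (hm : StrictMono fun t : ℝ => τ t) (hξ : IsEmbedding ξ₁) {t : ℝ}
    (hd : DifferentiableAt ℝ (paramLift v τ) (τ t)) (ℓ : Submodule ℝ (Wedge n)) :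
    IsTangentLine (Set.range ξ₁) (ξ₁ t) ℓ ↔ ℓ = planeOf (v t) (deriv (paramLift v τ) (τ t)) := by
  have hfilter : 𝓝[Set.range ξ₁ \ {ξ₁ t}] (ξ₁ t) =
      map (fun s : ℝ => ξ₁ s) (𝓝[≠] t) := by
    have e1 : Set.range ξ₁ \ {ξ₁ t} = ξ₁ '' {(t : Bdry)}ᶜ := by
      rw [Set.image_compl_eq_range_sdiff_image hξ.injective, Set.image_singleton]
    rw [e1, ← hξ.map_nhdsWithin_eq, OnePoint.nhdsWithin_coe, Filter.map_map]
    congr 2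
    ext s
    simp
  have htends : Tendsto (fun q : ℙ ℝ (Wedge n) => subspaceProj ((ξ₁ t).submodule ⊔ q.submodule))
      (𝓝[Set.range ξ₁ \ {ξ₁ t}] (ξ₁ t))
      (𝓝 (subspaceProj (planeOf (v t) (deriv (paramLift v τ) (τ t))))) := by
    rw [hfilter, tendsto_map'_iff]
    have hslope : Tendsto (fun s : ℝ => slope (paramLift v τ) (τ t) (τ s)) (𝓝[≠] t)
        (𝓝 (deriv (paramLift v τ) (τ t))) := by
      have e1 := hasDerivAt_iff_tendsto_slope.mp hd.hasDerivAt
      refine e1.comp (tendsto_nhdsWithin_iff.mpr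
        ⟨h.continuous_param.continuousAt.tendsto.mono_left nhdsWithin_le_nhds, ?_⟩)
      filter_upwards [self_mem_nhdsWithin] with s hs
      exact fun he => hs (hm.injective he)
    have e2 := tendsto_starProjection_span_pair (h.deriv_notMem_span hm hd) hslope
    have e3 : subspaceProj (planeOf (v t) (deriv (paramLift v τ) (τ t))) =
        (Submodule.span ℝ {v t} ⊔
          Submodule.span ℝ {deriv (paramLift v τ) (τ t)}).starProjection := by
      simp only [subspaceProj, map_planeOf]
    rw [e3]
    refine e2.congr' ?_
    filter_upwards [self_mem_nhdsWithin] with s hs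
    have hne : τ s - τ t ≠ 0 := sub_ne_zero.mpr fun he => hs (hm.injective he)
    have e4 : Submodule.span ℝ {v t} ⊔
        Submodule.span ℝ {slope (paramLift v τ) (τ t) (τ s)} =
        Submodule.span ℝ {v t} ⊔ Submodule.span ℝ {v s} := by
      have e5 : slope (paramLift v τ) (τ t) (τ s) = (τ s - τ t)⁻¹ • (v s - v t) := by
        simp only [slope, vsub_eq_sub, paramLift_param hm]
      rw [e5, Submodule.span_singleton_smul_eq (isUnit_iff_ne_zero.mpr (inv_ne_zero hne))]
      have ht : ∀ u : WedgeEuc n, v t ∈ Submodule.span ℝ {v t} ⊔ Submodule.span ℝ {u} := fun u =>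
        Submodule.mem_sup_left (Submodule.mem_span_singleton_self _)
      have hu : ∀ u : WedgeEuc n, u ∈ Submodule.span ℝ {v t} ⊔ Submodule.span ℝ {u} := fun u =>
        Submodule.mem_sup_right (Submodule.mem_span_singleton_self _)
      apply le_antisymm
      · refine sup_le le_sup_left ((Submodule.span_singleton_le_iff_mem _ _).mpr ?_)
        exact Submodule.sub_mem _ (hu _) (ht _)
      · refine sup_le le_sup_left ((Submodule.span_singleton_le_iff_mem _ _).mpr ?_)
        have := Submodule.add_mem _ (hu (v s - v t)) (ht (v s - v t))
        rwa [sub_add_cancel] at this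
    have e6 : ((ξ₁ t).submodule ⊔ (ξ₁ s).submodule).map (wedgeCoord n).toLinearMap =
        Submodule.span ℝ {v t} ⊔ Submodule.span ℝ {v s} := by
      rw [Submodule.map_sup, h.span_eq _ (OnePoint.coe_ne_infty t),
        h.span_eq _ (OnePoint.coe_ne_infty s)]
    simp only [Function.comp_apply, subspaceProj, e6, e4]
  constructor
  · intro hℓ
    have : NeBot (𝓝[Set.range ξ₁ \ {ξ₁ t}] (ξ₁ t)) := by
      rw [hfilter]; infer_instance
    exact subspaceProj_injective (tendsto_nhds_unique hℓ.2 htends)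
  · rintro rfl
    exact ⟨finrank_planeOf (h.lift_ne_zero _) (h.deriv_notMem_span hm hd), htends⟩

theorem mem_transversePairs_iff (h : IsChartCurve ξ₁ OnePoint.infty v τ)
    (hm : StrictMono fun t : ℝ => τ t) (hξ : IsEmbedding ξ₁) {s t : ℝ}
    (hs : DifferentiableAt ℝ (paramLift v τ) (τ s))
    (ht : DifferentiableAt ℝ (paramLift v τ) (τ t)) :
    ((s : Bdry), (t : Bdry)) ∈ transversePairs ξ₁ ↔ s ≠ t ∧
      gram (v s) (deriv (paramLift v τ) (τ s)) (v t) (deriv (paramLift v τ) (τ t)) ≠ 0 := by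
  rw [← isCompl_planeOf_iff (h.lift_ne_zero _) (h.deriv_notMem_span hm ht)]
  simp only [transversePairs, Set.mem_ofPred_eq, h.isTangentLine_iff hm hξ hs,
    h.isTangentLine_iff hm hξ ht]
  constructor
  · rintro ⟨hne, _, _, rfl, rfl, hc⟩
    exact ⟨fun he => hne (by rw [he]), hc⟩
  · rintro ⟨hne, hc⟩
    exact ⟨fun he => hne (OnePoint.coe_injective he), _, _, rfl, rfl, hc⟩

end IsChartCurve

end Param

/-! ### The length measure -/

section Length

theorem pullbackLength_apply {S X : Type*} [TopologicalSpace S] [CompactSpace S] [MeasurableSpace S]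
    [BorelSpace S] [D : MetricSpace X] {f : S → X}
    (hf : ∀ x, Tendsto (fun y => dist (f y) (f x)) (𝓝 x) (𝓝 0)) (hinj : Function.Injective f)
    (A : Set S) :
    pullbackLength D f A =
      (letI : MeasurableSpace X := borel X
       haveI : BorelSpace X := ⟨rfl⟩
       Measure.hausdorffMeasure 1 (f '' A)) := by
  have hc : Continuous f :=
    continuous_iff_continuousAt.mpr fun x => tendsto_iff_dist_tendsto_zero.mpr (hf x)
  let : MeasurableSpace X := borel X
  have : BorelSpace X := ⟨rfl⟩
  exact (hc.isClosedEmbedding hinj).measurableEmbedding.comap_apply _ A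

theorem pullbackLength_comparison {S X : Type*} [TopologicalSpace S] [CompactSpace S]
    [MeasurableSpace S] [BorelSpace S] [D : MetricSpace X] {f : S → X}
    (hf : ∀ x, Tendsto (fun y => dist (f y) (f x)) (𝓝 x) (𝓝 0)) (hinj : Function.Injective f)
    {τ : S → ℝ} {A : Set S} {C : ℝ} (hC : 0 ≤ C)
    (h : ∀ x ∈ A, ∀ y ∈ A, dist (f x) (f y) ≤ C * |τ x - τ y| ∧
      |τ x - τ y| ≤ C * dist (f x) (f y)) :
    pullbackLength D f A ≤ ENNReal.ofReal C * volume (τ '' A) ∧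
      volume (τ '' A) ≤ ENNReal.ofReal C * pullbackLength D f A := by
  let : MeasurableSpace X := borel X
  have : BorelSpace X := ⟨rfl⟩
  rw [pullbackLength_apply hf hinj, ← hausdorffMeasure_real]
  exact ⟨hausdorffMeasure_image_le_of_dist_le hC fun x hx y hy => (h x hx y hy).1,
    hausdorffMeasure_image_le_of_dist_le hC fun x hx y hy => (h x hx y hy).2⟩

variable {n : ℕ} {ξ₁ : Bdry → ℙ ℝ (Wedge n)} {v : Bdry → WedgeEuc n} {τ : Bdry → ℝ}

theorem tendsto_stdDist (hc : Continuous ξ₁) (x : Bdry) :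
    Tendsto (fun y => stdDist (ξ₁ y) (ξ₁ x)) (𝓝 x) (𝓝 0) :=
  tendsto_iff_dist_tendsto_zero.mp (hc.tendsto x)

theorem IsBiLipschitzToStd.tendsto_dist (hc : Continuous ξ₁) {D : MetricSpace (ℙ ℝ (Wedge n))}
    (hD : IsBiLipschitzToStd D) (x : Bdry) :
    Tendsto (fun y => D.dist (ξ₁ y) (ξ₁ x)) (𝓝 x) (𝓝 0) := by
  obtain ⟨K, hK, hD⟩ := hD
  have h1 : Tendsto (fun y => K * stdDist (ξ₁ y) (ξ₁ x)) (𝓝 x) (𝓝 0) := by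
    have := (tendsto_stdDist hc x).const_mul K
    rwa [mul_zero] at this
  exact squeeze_zero (fun y => @dist_nonneg _ D.toPseudoMetricSpace _ _)
    (fun y => (hD _ _).1) h1

theorem IsChartCurve.measure_comparison {x₀ : Bdry} (h : IsChartCurve ξ₁ x₀ v τ)
    (hc : Continuous ξ₁) {D : MetricSpace (ℙ ℝ (Wedge n))} (hD : IsBiLipschitzToStd D)
    (hinj : Function.Injective ξ₁) {K : Set Bdry} (hK : IsCompact K) (hx₀ : x₀ ∉ K) :
    ∃ C : ℝ, ∀ A ⊆ K, pullbackLength D ξ₁ A ≤ ENNReal.ofReal C * volume (τ '' A) ∧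
      volume (τ '' A) ≤ ENNReal.ofReal C * pullbackLength D ξ₁ A := by
  obtain ⟨C, hC, hCK⟩ := h.exists_dist_comparison hK hx₀
  obtain ⟨L, hL, hLD⟩ := id hD
  refine ⟨L * C, fun A hA => ?_⟩
  refine @pullbackLength_comparison _ _ _ _ _ _ D _ (hD.tendsto_dist hc) hinj _ _ _
    (by positivity) fun x hx y hy => ?_
  obtain ⟨h1, h2⟩ := hCK x (hA hx) y (hA hy)
  obtain ⟨h3, h4⟩ := hLD (ξ₁ x) (ξ₁ y)
  constructor
  · calc _ ≤ L * stdDist (ξ₁ x) (ξ₁ y) := h3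
      _ ≤ L * (C * |τ x - τ y|) := by gcongr; exact h1
      _ = _ := by ring
  · calc _ ≤ C * stdDist (ξ₁ x) (ξ₁ y) := h2
      _ ≤ C * (L * D.dist (ξ₁ x) (ξ₁ y)) := by gcongr
      _ = _ := by ring

theorem IsChartCurve.measure_lt_top {x₀ : Bdry} (h : IsChartCurve ξ₁ x₀ v τ)
    (hc : Continuous ξ₁) {D : MetricSpace (ℙ ℝ (Wedge n))} (hD : IsBiLipschitzToStd D)
    (hinj : Function.Injective ξ₁) {K : Set Bdry} (hK : IsCompact K) (hx₀ : x₀ ∉ K) :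
    pullbackLength D ξ₁ K < ⊤ := by
  obtain ⟨C, hC⟩ := h.measure_comparison hc hD hinj hK hx₀
  refine (hC K subset_rfl).1.trans_lt (ENNReal.mul_lt_top ENNReal.ofReal_lt_top ?_)
  refine (hK.image_of_continuousOn fun x hx => ?_).measure_lt_top
  exact (h.continuousAt_param fun he => hx₀ (he ▸ hx)).continuousWithinAt

/-- In the chart at `∞`, the null sets of the length measure are those of the parameter. -/
theorem IsChartCurve.measure_image_coe_eq_zero_iff (h : IsChartCurve ξ₁ OnePoint.infty v τ)
    (hc : Continuous ξ₁) {D : MetricSpace (ℙ ℝ (Wedge n))} (hD : IsBiLipschitzToStd D)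
    (hinj : Function.Injective ξ₁) (A : Set ℝ) :
    pullbackLength D ξ₁ ((fun t : ℝ => (t : Bdry)) '' A) = 0 ↔
      volume ((fun t : ℝ => τ t) '' A) = 0 := by
  have hA : A = ⋃ k : ℕ, A ∩ Set.Icc (-k : ℝ) k := by
    rw [← Set.inter_iUnion]
    refine (Set.inter_eq_left.mpr fun t _ => Set.mem_iUnion.mpr ?_).symm
    obtain ⟨k, hk⟩ := exists_nat_ge |t|
    exact ⟨k, abs_le.mp hk⟩
  rw [hA, Set.image_iUnion, Set.image_iUnion, measure_iUnion_null_iff, measure_iUnion_null_iff]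
  refine forall_congr' fun k => ?_
  obtain ⟨C, hC⟩ := h.measure_comparison hc hD hinj
    (K := (fun t : ℝ => (t : Bdry)) '' Set.Icc (-k : ℝ) k)
    (isCompact_Icc.image OnePoint.continuous_coe) (by simp)
  obtain ⟨h1, h2⟩ := hC _ (Set.image_mono (f := fun t : ℝ => (t : Bdry))
    (Set.inter_subset_right (s := A)))
  rw [Set.image_image] at h1 h2
  constructor
  · intro h0
    rw [h0, mul_zero] at h2
    exact le_antisymm h2 zero_le
  · intro h0
    rw [h0, mul_zero] at h1
    exact le_antisymm h1 zero_le

end Length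

/-! ### Transverse pairs -/

section Transverse

variable {n : ℕ} {ξ₁ : Bdry → ℙ ℝ (Wedge n)} {v : Bdry → WedgeEuc n} {τ : Bdry → ℝ}

/-- The pairs of distinct parameters at which the lift is differentiable and the tangent lines are
transverse. -/
def gramPairs (v : Bdry → WedgeEuc n) (τ : Bdry → ℝ) : Set (ℝ × ℝ) :=
  {z | z.1 ≠ z.2 ∧ DifferentiableAt ℝ (paramLift v τ) (τ z.1) ∧
    DifferentiableAt ℝ (paramLift v τ) (τ z.2) ∧
    gram (v z.1) (deriv (paramLift v τ) (τ z.1)) (v z.2) (deriv (paramLift v τ) (τ z.2)) ≠ 0}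

theorem continuous_omegaE : Continuous fun p : WedgeEuc n × WedgeEuc n => omegaE n p.1 p.2 :=
  (omegaE n).toContinuousBilinearMap.continuous₂

theorem measurable_omegaE {α : Type*} [MeasurableSpace α] {f g : α → WedgeEuc n}
    (hf : Measurable f) (hg : Measurable g) : Measurable fun z => omegaE n (f z) (g z) :=
  Continuous.measurable2 (c := fun x y => omegaE n x y) continuous_omegaE hf hg

theorem IsChartCurve.measurableSet_gramPairs (h : IsChartCurve ξ₁ OnePoint.infty v τ) :
    MeasurableSet (gramPairs v τ) := by
  have hτ : Measurable fun t : ℝ => τ t := h.continuous_param.measurable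
  have hv : Measurable fun t : ℝ => v t := h.continuous_lift.measurable
  have hd : Measurable fun t : ℝ => deriv (paramLift v τ) (τ t) :=
    (measurable_deriv _).comp hτ
  have hD : MeasurableSet {t : ℝ | DifferentiableAt ℝ (paramLift v τ) (τ t)} :=
    hτ (measurableSet_of_differentiableAt ℝ (paramLift v τ))
  have hv1 : Measurable fun z : ℝ × ℝ => v z.1 := hv.comp measurable_fst
  have hv2 : Measurable fun z : ℝ × ℝ => v z.2 := hv.comp measurable_snd
  have hd1 : Measurable fun z : ℝ × ℝ => deriv (paramLift v τ) (τ z.1) := hd.comp measurable_fst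
  have hd2 : Measurable fun z : ℝ × ℝ => deriv (paramLift v τ) (τ z.2) := hd.comp measurable_snd
  have hg : Measurable fun z : ℝ × ℝ =>
      gram (v z.1) (deriv (paramLift v τ) (τ z.1)) (v z.2) (deriv (paramLift v τ) (τ z.2)) := by
    unfold gram
    exact ((measurable_omegaE hv2 hv1).mul (measurable_omegaE hd2 hd1)).sub
      ((measurable_omegaE hv2 hd1).mul (measurable_omegaE hd2 hv1))
  have hset : gramPairs v τ = {z : ℝ × ℝ | z.1 = z.2}ᶜ ∩ (Prod.fst ⁻¹'
      {t : ℝ | DifferentiableAt ℝ (paramLift v τ) (τ t)} ∩ (Prod.snd ⁻¹'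
      {t : ℝ | DifferentiableAt ℝ (paramLift v τ) (τ t)} ∩ (fun z : ℝ × ℝ => gram (v z.1)
        (deriv (paramLift v τ) (τ z.1)) (v z.2) (deriv (paramLift v τ) (τ z.2))) ⁻¹' {0}ᶜ)) := by
    ext z
    simp only [gramPairs, Set.mem_ofPred_eq, Set.mem_inter_iff, Set.mem_compl_iff,
      Set.mem_preimage, Set.mem_singleton_iff, ne_eq]
  rw [hset]
  exact ((measurableSet_eq_fun measurable_fst measurable_snd).compl).inter
    ((measurable_fst hD).inter ((measurable_snd hD).inter (hg (measurableSet_singleton 0).compl)))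

theorem IsChartCurve.transversePairs_spec (h : IsChartCurve ξ₁ OnePoint.infty v τ)
    (hm : StrictMono fun t : ℝ => τ t) (hc : Continuous ξ₁) (hemb : IsEmbedding ξ₁)
    (hinj : Function.Injective ξ₁)
    {D : MetricSpace (ℙ ℝ (Wedge n))}
    (hD : IsBiLipschitzToStd D) (m : Measure Bdry) [IsFiniteMeasure m] (hmD : m = pullbackLength D ξ₁) :
    NullMeasurableSet (transversePairs ξ₁) (m.prod m) ∧ 0 < (m.prod m) (transversePairs ξ₁) := by
  have hnull : ∀ A : Set ℝ, m ((fun t : ℝ => (t : Bdry)) '' A) = 0 ↔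
      volume ((fun t : ℝ => τ t) '' A) = 0 := by
    rw [hmD]
    exact h.measure_image_coe_eq_zero_iff hc hD hinj
  have hlip := h.exists_lipschitzOnWith_paramLift hm
  set G : Set Bdry := (fun t : ℝ => (t : Bdry)) ''
    {t : ℝ | DifferentiableAt ℝ (paramLift v τ) (τ t)} with hG
  have hGm : ∀ᵐ x ∂m, x ∈ G := by
    have h1 : m ((fun t : ℝ => (t : Bdry)) ''
        {t : ℝ | ¬ DifferentiableAt ℝ (paramLift v τ) (τ t)}) = 0 := by
      rw [hnull]
      have := ae_differentiableAt_of_lipschitzOnWith_Icc (h.isOpen_paramRange hm) hlip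
      refine measure_mono_null ?_ this
      rintro _ ⟨t, ht, rfl⟩ hcon
      exact ht (hcon ⟨t, rfl⟩)
    have h2 : m {(OnePoint.infty : Bdry)} = 0 := by
      obtain ⟨C, hC⟩ := pullbackLength_comparison (D := D) (f := ξ₁) (τ := fun _ => (0 : ℝ))
        (A := {(OnePoint.infty : Bdry)}) (C := 0) (hD.tendsto_dist hc) hinj le_rfl (by simp)
      rw [hmD]
      simpa using C
    refine measure_mono_null ?_ (measure_union_null h1 h2)
    intro x hx
    induction x using OnePoint.rec with
    | infty => exact Or.inr rfl
    | coe t => exact Or.inl ⟨t, fun ht => hx ⟨t, ht, rfl⟩, rfl⟩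
  set P : Set (Bdry × Bdry) := Prod.map (fun t : ℝ => (t : Bdry)) (fun t : ℝ => (t : Bdry)) ''
    gramPairs v τ with hP
  have hcoe : MeasurableEmbedding (fun t : ℝ => (t : Bdry)) :=
    OnePoint.isOpenEmbedding_coe.measurableEmbedding
  have hPm : MeasurableSet P :=
    (hcoe.prodMap hcoe).measurableSet_image.mpr h.measurableSet_gramPairs
  have hmemP : ∀ s t : ℝ, ((s : Bdry), (t : Bdry)) ∈ P ↔ (s, t) ∈ gramPairs v τ := by
    intro s t
    constructor
    · rintro ⟨⟨a, b⟩, hab, he⟩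
      rw [Prod.map_apply, Prod.mk.injEq] at he
      rwa [← OnePoint.coe_injective he.1, ← OnePoint.coe_injective he.2]
    · intro hst
      exact ⟨(s, t), hst, rfl⟩
  have hae : P =ᵐ[m.prod m] transversePairs ξ₁ := by
    have hG1 : ∀ᵐ z ∂(m.prod m), z.1 ∈ G := Measure.quasiMeasurePreserving_fst.ae hGm
    have hG2 : ∀ᵐ z ∂(m.prod m), z.2 ∈ G := Measure.quasiMeasurePreserving_snd.ae hGm
    filter_upwards [hG1, hG2] with z hz1 hz2
    obtain ⟨x, y⟩ := z
    obtain ⟨s, hs, rfl⟩ := hz1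
    obtain ⟨t, ht, rfl⟩ := hz2
    refine propext ?_
    change ((s : Bdry), (t : Bdry)) ∈ P ↔ ((s : Bdry), (t : Bdry)) ∈ transversePairs ξ₁
    rw [hmemP, h.mem_transversePairs_iff hm hemb hs ht]
    exact ⟨fun hz => ⟨hz.1, hz.2.2.2⟩, fun hz => ⟨hz.1, hs, ht, hz.2⟩⟩
  refine ⟨hPm.nullMeasurableSet.congr hae, ?_⟩
  rw [← measure_congr hae, pos_iff_ne_zero]
  intro hzero
  rw [Measure.measure_prod_null hPm] at hzero
  refine not_ae_gram_eq_zero (h.isOpen_paramRange hm) ⟨τ (0 : ℝ), 0, rfl⟩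
    h.ordConnected_paramRange hlip (omegaE n) ?_ ?_ ?_
  · intro s _
    exact h.omegaE_self _
  · rintro _ ⟨a, rfl⟩ _ ⟨b, rfl⟩ hne
    simp only [paramLift_param hm]
    exact h.omegaE_ne _ _ (OnePoint.coe_ne_infty _) (OnePoint.coe_ne_infty _)
      (fun he => hne (by rw [OnePoint.coe_injective he]))
  · have h1 : m ((fun t : ℝ => (t : Bdry)) '' {a : ℝ | m (Prod.mk (a : Bdry) ⁻¹' P) ≠ 0}) = 0 := by
      refine measure_mono_null ?_ hzero
      rintro _ ⟨a, ha, rfl⟩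
      exact ha
    rw [hnull] at h1
    filter_upwards [measure_eq_zero_iff_ae_notMem.mp h1] with s hs hsJ
    obtain ⟨a, rfl⟩ := hsJ
    have ha : m (Prod.mk (a : Bdry) ⁻¹' P) = 0 := by
      by_contra hcon
      exact hs ⟨a, hcon, rfl⟩
    have h2 : m ((fun t : ℝ => (t : Bdry)) '' {b : ℝ | ((a : Bdry), (b : Bdry)) ∈ P}) = 0 := by
      refine measure_mono_null ?_ ha
      rintro _ ⟨b, hb, rfl⟩
      exact hb
    rw [hnull] at h2
    filter_upwards [measure_eq_zero_iff_ae_notMem.mp h2] with t ht htJ hne hda hdb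
    obtain ⟨b, rfl⟩ := htJ
    by_contra hcon
    refine ht ⟨b, (hmemP a b).mpr ⟨fun he => hne (congrArg (fun t : ℝ => τ t) he), hda, hdb, ?_⟩, rfl⟩
    simp only [paramLift_param hm] at hcon
    exact hcon

end Transverse

end MaxRep
end

theorem mainTheorem6 (n : ℕ) (hn : 1 < n)
    (Γ : Subgroup MaxRep.PSL2) (hdisc : DiscreteTopology Γ)
    (hΛ : MaxRep.limitSet Γ = Set.univ)
    (ρ : Γ →* MaxRep.Sp n) (ξ : MaxRep.Bdry → MaxRep.Flag n)
    (hξ : MaxRep.IsMaximalLimitMap Γ ρ ξ)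
    (D : MetricSpace (ℙ ℝ (MaxRep.Wedge n))) (hD : MaxRep.IsBiLipschitzToStd D)
    (m : MeasureTheory.Measure MaxRep.Bdry)
    (hm : m = MaxRep.pullbackLength D (MaxRep.plucker ∘ ξ)) :
    MeasureTheory.IsFiniteMeasure m ∧
      MeasureTheory.NullMeasurableSet (MaxRep.transversePairs (MaxRep.plucker ∘ ξ)) (m.prod m) ∧
      0 < (m.prod m) (MaxRep.transversePairs (MaxRep.plucker ∘ ξ)) := by
  have hn0 : 0 < n := by omega
  have hpos := hξ.positive 3 le_rfl
  have hc := MaxRep.plucker_comp_continuous hn0 hξ.continuous hpos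
  have hinj := MaxRep.plucker_comp_injective hn0 hξ.continuous hpos
  have hemb := MaxRep.plucker_comp_isEmbedding hn0 hξ.continuous hpos
  obtain ⟨v, τ, h, hmono⟩ :=
    MaxRep.exists_isChartCurve_strictMono hn0 hξ.continuous hpos
  obtain ⟨v₀, τ₀, h₀⟩ :=
    MaxRep.exists_isChartCurve hn0 hξ.continuous hpos ((0 : ℝ) : MaxRep.Bdry)
  have hfin : MeasureTheory.IsFiniteMeasure m := by
    refine ⟨?_⟩
    rw [hm]
    have h1 := h.measure_lt_top hc hD hinj
      (K := (fun t : ℝ => (t : MaxRep.Bdry)) '' Set.Icc (-1) 1)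
      (isCompact_Icc.image OnePoint.continuous_coe) (by simp)
    have h2 := h₀.measure_lt_top hc hD hinj
      (K := ((fun t : ℝ => (t : MaxRep.Bdry)) '' Set.Ioo (-1) 1)ᶜ)
      (OnePoint.isOpenEmbedding_coe.isOpenMap _ isOpen_Ioo).isClosed_compl.isCompact
      (by simp)
    refine lt_of_le_of_lt ((measure_mono ?_).trans (measure_union_le _ _))
      (ENNReal.add_lt_top.mpr ⟨h1, h2⟩)
    intro x _
    by_cases hx : x ∈ (fun t : ℝ => (t : MaxRep.Bdry)) '' Set.Ioo (-1) 1
    · exact Or.inl (Set.image_mono Set.Ioo_subset_Icc_self hx)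
    · exact Or.inr hx
  exact ⟨hfin, h.transversePairs_spec hmono hc hemb hinj hD m hm⟩
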